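/- Let $M$ be a complex manifold of complex dimension $n\ge 3$ with complex structure $J$, let $g$ be a smooth Hermitian metric on $M$ (a Riemannian metric with $g(JX,JY)=g(X,Y)$), and let $\omega(X,Y)=g(JX,Y)$ be its fundamental form; $M$ need not be compact. In local holomorphic coordinates $\omega=\sqrt{-1}\,h_{i\bar j}\,dz^i\wedge d\bar z^j$, where $h_{i\bar j}$ is the value of the $\mathbb C$-bilinear extension of $g$ on $(\partial/\partial z^i,\partial/\partial\bar z^j)$; let $(h^{i\bar j})$ be the transposed inverse matrix, $\sum_j h^{i\bar j}h_{k\bar j}=\delta_{ik}$. Let $R_{i\bar jk\bar l}=-h_{p\bar l}\,\partial_{\bar j}\bigl(h^{p\bar q}\partial_i h_{k\bar q}\bigr)$ be the curvature tensor of the Chern connection, with scalar curvatures $$s=h^{i\bar j}h^{k\bar l}R_{i\bar jk\bar l},\qquad \hat s=h^{i\bar l}h^{k\bar j}R_{i\bar jk\bar l}.$$ Let $\langle\cdot,\cdot\rangle$ and $|\cdot|^2$ be the pointwise Hermitian inner product and squared norm on complex-valued forms induced by $g$ (normalized by $\langle\alpha_1\wedge\dots\wedge\alpha_p,\beta_1\wedge\dots\wedge\beta_p\rangle=\det\langle\alpha_i,\beta_j\rangle$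 on real $1$-forms), let $*$ be the $\mathbb C$-linear Hodge operator given by $\varphi\wedge *\bar\psi=\langle\varphi,\psi\rangle\,\omega^n/n!$, let $\partial^*=-*\bar\partial*$ be the formal adjoint of $\partial$, and let $\Lambda$ be the pointwise adjoint of $\varphi\mapsto\omega\wedge\varphi$. Let $k$ be an integer with $1\le k\le n-1$. Then the following are equivalent: 1. $\omega$ is $k$-Gauduchon, that is, $\sqrt{-1}\,\partial\bar\partial\omega^k\wedge\omega^{n-k-1}=0$ on $M$; 2. $\Lambda^{k+1}\bigl(\sqrt{-1}\,\partial\bar\partial\omega^k\bigr)=0$ on $M$; 3. $s-\hat s=\dfrac{k-1}{n-2}\,|\partial^*\omega|^2+\dfrac{n-1-k}{n-2}\,|\partial\omega|^2$ on $M$. -/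

import Mathlib

open scoped Manifold ContDiff ComplexConjugate

noncomputable section

namespace HermitianGeometry

/-! ### Complex-valued differential forms on (open subsets of) `ℂⁿ` -/

/-- The model space `ℂⁿ`. -/
abbrev Cn (n : ℕ) : Type := EuclideanSpace ℂ (Fin n)

/-- Values of complex-valued differential forms of degree `p` on `ℂⁿ`:
real-multilinear alternating maps in `p` tangent vectors, with values in `ℂ`. -/
abbrev Form (n p : ℕ) : Type := (Cn n) [⋀^Fin p]→L[ℝ] ℂ

/-- Transport of a form along an equality of degrees. -/
def castForm {n p q : ℕ} (h : p = q) (η : Form n p) : Form n q := h ▸ η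

/-- The multilinear map `α ⊗ β : (v₁, …, v_{p+q}) ↦ α(v₁, …, v_p) β(v_{p+1}, …, v_{p+q})`. -/
def tensor {n p q : ℕ} (α : Form n p) (β : Form n q) :
    ContinuousMultilinearMap ℝ (fun _ : Fin (p + q) => Cn n) ℂ where
  toMultilinearMap := (LinearMap.mul' ℝ ℂ).compMultilinearMap
    ((α.toAlternatingMap.toMultilinearMap.domCoprod
      β.toAlternatingMap.toMultilinearMap).domDomCongr finSumFinEquiv)
  cont := by
    change Continuous fun v : Fin (p + q) → Cn n =>
      α (fun i => v (finSumFinEquiv (Sum.inl i))) * β (fun i => v (finSumFinEquiv (Sum.inr i)))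
    fun_prop

theorem tensor_apply {n p q : ℕ} (α : Form n p) (β : Form n q) (v : Fin (p + q) → Cn n) :
    tensor α β v = α (fun i => v (Fin.castAdd q i)) * β (fun i => v (Fin.natAdd p i)) := rfl

/-- The wedge product `α ∧ β = (1 / (p! q!)) ∑_σ sign(σ) (α ⊗ β) ∘ σ`
(equivalently, the signed sum over shuffles), so that
`(dx¹ ∧ dx²)(v, w) = dx¹(v) dx²(w) - dx¹(w) dx²(v)`. -/
def wedge {n p q : ℕ} (α : Form n p) (β : Form n q) : Form n (p + q) :=
  ((p.factorial * q.factorial : ℂ)⁻¹) • ContinuousMultilinearMap.alternatization (tensor α β)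

/-- Wedge powers `αᵏ = α ∧ ⋯ ∧ α` of a `2`-form. -/
def wedgePow {n : ℕ} (α : Form n 2) : (k : ℕ) → Form n (2 * k)
  | 0 => ContinuousAlternatingMap.constOfIsEmpty ℝ (Cn n) (Fin 0) (1 : ℂ)
  | k + 1 => wedge (wedgePow α k) α

/-- The complex structure `J`, i.e. multiplication by `√-1` on tangent vectors. -/
def J (n : ℕ) : Cn n →L[ℝ] Cn n := Complex.I • ContinuousLinearMap.id ℝ (Cn n)

/-- The `ℂ`-linear part `v ↦ (D v - √-1 D (J v)) / 2 = ∑ᵢ dzⁱ(v) D(∂/∂zⁱ)` of an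
`ℝ`-linear map into a complex vector space. -/
def linPart {n p : ℕ} (D : Cn n →L[ℝ] Form n p) : Cn n →L[ℝ] Form n p :=
  (1 / 2 : ℂ) • (D - Complex.I • D.comp (J n))

/-- The `ℂ`-antilinear part `v ↦ (D v + √-1 D (J v)) / 2 = ∑ᵢ dz̄ⁱ(v) D(∂/∂z̄ⁱ)` of an
`ℝ`-linear map into a complex vector space. -/
def antilinPart {n p : ℕ} (D : Cn n →L[ℝ] Form n p) : Cn n →L[ℝ] Form n p :=
  (1 / 2 : ℂ) • (D + Complex.I • D.comp (J n))

/-- The operator `∂η = ∑ᵢ dzⁱ ∧ ∂η/∂zⁱ`. It is Mathlib's exterior derivative `extDeriv`, with the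
derivative of the coefficients replaced by its `ℂ`-linear part; on forms of type `(p,q)` it is the
component of `dη` of type `(p+1,q)`. -/
def del {n p : ℕ} (η : Cn n → Form n p) (z : Cn n) : Form n (p + 1) :=
  ContinuousAlternatingMap.alternatizeUncurryFin (linPart (fderiv ℝ η z))

/-- The operator `∂̄η = ∑ᵢ dz̄ⁱ ∧ ∂η/∂z̄ⁱ`; on forms of type `(p,q)` it is the component of `dη` of
type `(p,q+1)`. -/
def delbar {n p : ℕ} (η : Cn n → Form n p) (z : Cn n) : Form n (p + 1) :=
  ContinuousAlternatingMap.alternatizeUncurryFin (antilinPart (fderiv ℝ η z))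

theorem del_add_delbar {n p : ℕ} (η : Cn n → Form n p) (z : Cn n) :
    del η z + delbar η z = extDeriv η z := by
  have h : linPart (fderiv ℝ η z) + antilinPart (fderiv ℝ η z) = fderiv ℝ η z := by
    unfold linPart antilinPart
    module
  rw [del, delbar, ← ContinuousAlternatingMap.alternatizeUncurryFin_add, h, extDeriv]

/-- The tangent vector `∂/∂xⁱ`, where `zⁱ = xⁱ + √-1 yⁱ`; also, `∂/∂yⁱ = J ∂/∂xⁱ`. -/
def e {n : ℕ} (i : Fin n) : Cn n := EuclideanSpace.single i 1

/-- The form `dzⁱ`. -/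
def dz {n : ℕ} (i : Fin n) : Form n 1 :=
  ContinuousAlternatingMap.ofSubsingleton ℝ (Cn n) ℂ (0 : Fin 1)
    ((EuclideanSpace.proj i : Cn n →L[ℂ] ℂ).restrictScalars ℝ)

/-- The form `dz̄ⁱ`. -/
def dzbar {n : ℕ} (i : Fin n) : Form n 1 :=
  ContinuousAlternatingMap.ofSubsingleton ℝ (Cn n) ℂ (0 : Fin 1)
    ((Complex.conjCLE : ℂ →L[ℝ] ℂ).comp
      ((EuclideanSpace.proj i : Cn n →L[ℂ] ℂ).restrictScalars ℝ))

/-- Contraction `ι_{∂/∂zⁱ}` with `∂/∂zⁱ = (∂/∂xⁱ - √-1 ∂/∂yⁱ) / 2`. -/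
def iota {n p : ℕ} (i : Fin n) (η : Form n (p + 1)) : Form n p :=
  (1 / 2 : ℂ) • (η.curryLeft (e i) - Complex.I • η.curryLeft (J n (e i)))

/-- Contraction `ι_{∂/∂z̄ⁱ}` with `∂/∂z̄ⁱ = (∂/∂xⁱ + √-1 ∂/∂yⁱ) / 2`. -/
def iotabar {n p : ℕ} (i : Fin n) (η : Form n (p + 1)) : Form n p :=
  (1 / 2 : ℂ) • (η.curryLeft (e i) + Complex.I • η.curryLeft (J n (e i)))

/-- The derivative `∂f/∂zⁱ` of a complex-valued function. -/
def pd {n : ℕ} (i : Fin n) (f : Cn n → ℂ) (z : Cn n) : ℂ :=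
  (1 / 2 : ℂ) * (fderiv ℝ f z (e i) - Complex.I * fderiv ℝ f z (J n (e i)))

/-- The derivative `∂f/∂z̄ⁱ` of a complex-valued function. -/
def pdbar {n : ℕ} (i : Fin n) (f : Cn n → ℂ) (z : Cn n) : ℂ :=
  (1 / 2 : ℂ) * (fderiv ℝ f z (e i) + Complex.I * fderiv ℝ f z (J n (e i)))

/-- The real coordinate frame `∂/∂x¹, …, ∂/∂xⁿ, ∂/∂y¹, …, ∂/∂yⁿ`. -/
def realFrame {n : ℕ} : Fin n ⊕ Fin n → Cn n := Sum.elim (fun i => e i) (fun i => J n (e i))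

/-- Contraction with `p` vectors in the first `p` slots:
`(contract u η)(w₁, …, w_q) = η(u₁, …, u_p, w₁, …, w_q)`. -/
def contract {n q : ℕ} : {p : ℕ} → (Fin p → Cn n) → Form n (q + p) → Form n q
  | 0, _, η => η
  | p + 1, u, η => contract (p := p) (fun i => u i.succ) (ContinuousAlternatingMap.curryLeft η (u 0))

/-! ### Hermitian geometry in a holomorphic coordinate chart

Here `G z u v` is the value `g(u, v)` of the Riemannian metric at the point with coordinate `z`,
on vectors `u, v` written in the coordinates. -/

section Local

variable {n : ℕ} (G : Cn n → Cn n → Cn n → ℝ)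

/-- The matrix `h_{ij̄} = h(∂/∂zⁱ, ∂/∂z̄ʲ)`, where `h` is the `ℂ`-bilinear extension of `g`. -/
def hMat (z : Cn n) : Matrix (Fin n) (Fin n) ℂ := fun i j =>
  (1 / 4 : ℂ) * ((G z (e i) (e j) : ℂ) + (G z (J n (e i)) (J n (e j)) : ℂ)
    + Complex.I * ((G z (e i) (J n (e j)) : ℂ) - (G z (J n (e i)) (e j) : ℂ)))

/-- The transposed inverse `h^{ij̄}`, characterised by `∑ⱼ h^{ij̄} h_{kj̄} = δᵢₖ`. -/
def hInv (z : Cn n) (i j : Fin n) : ℂ := (hMat G z)⁻¹ j i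

/-- The fundamental form `ω = √-1 ∑ h_{ij̄} dzⁱ ∧ dz̄ʲ`. -/
def fundamentalForm (z : Cn n) : Form n 2 :=
  Complex.I • ∑ i, ∑ j, hMat G z i j • wedge (dz i) (dzbar j)

/-- The power `ωᵏ` of the fundamental form. -/
def omegaPow (k : ℕ) (z : Cn n) : Form n (2 * k) := wedgePow (fundamentalForm G z) k

/-- The volume form `dv = ωⁿ / n!`. -/
def volumeForm (z : Cn n) : Form n (2 * n) := ((n.factorial : ℂ)⁻¹) • omegaPow G n z

/-- The inverse `g^{ab}` of the matrix of `g` in the real coordinate frame. -/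
def gInv (z : Cn n) : Matrix (Fin n ⊕ Fin n) (Fin n ⊕ Fin n) ℝ :=
  (Matrix.of fun a b => G z (realFrame a) (realFrame b))⁻¹

/-- The Hermitian inner product of forms induced by `g`,
`⟨φ, ψ⟩ = (1 / p!) g^{a₁b₁} ⋯ g^{a_pb_p} φ_{a₁…a_p} conj(ψ_{b₁…b_p})`. -/
def formInner (z : Cn n) {p : ℕ} (φ ψ : Form n p) : ℂ :=
  ((p.factorial : ℂ)⁻¹) * ∑ a : Fin p → Fin n ⊕ Fin n, ∑ b : Fin p → Fin n ⊕ Fin n,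
    (∏ t, (gInv G z (a t) (b t) : ℂ)) *
      φ (fun t => realFrame (a t)) * conj (ψ (fun t => realFrame (b t)))

/-- The Hodge operator `*`, extended `ℂ`-linearly to complex forms and determined by
`φ ∧ *ψ̄ = ⟨φ, ψ⟩ dv`. Explicitly,
`(*ψ)(w) = (1 / p!) g^{a₁b₁} ⋯ g^{a_pb_p} ψ_{a₁…a_p} dv(∂_{b₁}, …, ∂_{b_p}, w)`. -/
def hodge (z : Cn n) {p q : ℕ} (hpq : 2 * n = q + p) (ψ : Form n p) : Form n q :=
  ((p.factorial : ℂ)⁻¹) • ∑ a : Fin p → Fin n ⊕ Fin n, ∑ b : Fin p → Fin n ⊕ Fin n,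
    ((∏ t, (gInv G z (a t) (b t) : ℂ)) * ψ (fun t => realFrame (a t))) •
      contract (fun t => realFrame (b t)) (castForm hpq (volumeForm G z))

/-- The formal adjoint `∂* = -* ∂̄ *` of `∂` (forms of degree greater than `2n` vanish). -/
def delStar {p : ℕ} (η : Cn n → Form n (p + 1)) (z : Cn n) : Form n p :=
  if hp : p + 1 ≤ 2 * n then
    -hodge G z (p := 2 * n - (p + 1) + 1) (q := p) (by omega)
      (delbar (fun w => hodge G w (p := p + 1) (q := 2 * n - (p + 1)) (by omega) (η w)) z)
  else 0

/-- The operator `Λ = √-1 h^{ij̄} ι_{∂/∂zⁱ} ι_{∂/∂z̄ʲ}`, the pointwise adjoint of `ω ∧ ·`. -/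
def Lam (z : Cn n) {p : ℕ} (η : Form n (p + 2)) : Form n p :=
  Complex.I • ∑ i, ∑ j, hInv G z i j • iota i (iotabar j η)

/-- The iterate `Λʲ` on forms of degree `2j`. -/
def lamPow (z : Cn n) : (j : ℕ) → Form n (2 * j) → Form n 0
  | 0, η => η
  | j + 1, η => lamPow z j (Lam G z η)

/-- The form `√-1 ∂∂̄ωᵏ`. -/
def iDelDelbarOmegaPow (k : ℕ) (z : Cn n) : Form n (2 * (k + 1)) :=
  Complex.I • del (delbar (omegaPow G k)) z

/-- The Christoffel symbols `Γ_{ij}^k = h^{kl̄} ∂ᵢ h_{jl̄}` of the Chern connection. -/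
def christoffel (i j k : Fin n) (z : Cn n) : ℂ :=
  ∑ l, hInv G z k l * pd i (fun w => hMat G w j l) z

/-- The Chern curvature tensor `R_{ij̄kl̄} = -h_{pl̄} ∂_{j̄} Γ_{ik}^p`. -/
def chernCurv (i j k l : Fin n) (z : Cn n) : ℂ :=
  -∑ p, hMat G z p l * pdbar j (christoffel G i k p) z

/-- The Chern scalar curvature `s = h^{ij̄} h^{kl̄} R_{ij̄kl̄}`. -/
def chernScalar (z : Cn n) : ℂ :=
  ∑ i, ∑ j, ∑ k, ∑ l, hInv G z i j * hInv G z k l * chernCurv G i j k l z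

/-- The scalar curvature `ŝ = h^{il̄} h^{kj̄} R_{ij̄kl̄}`. -/
def chernScalarHat (z : Cn n) : ℂ :=
  ∑ i, ∑ j, ∑ k, ∑ l, hInv G z i l * hInv G z k j * chernCurv G i j k l z

/-- `|∂ω|²`. -/
def normSqDelOmega (z : Cn n) : ℂ :=
  formInner G z (del (fundamentalForm G) z) (del (fundamentalForm G) z)

/-- `|∂*ω|²`. -/
def normSqDelStarOmega (z : Cn n) : ℂ :=
  formInner G z (delStar G (fundamentalForm G) z) (delStar G (fundamentalForm G) z)

end Local

/-! ### Hermitian manifolds -/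

section Global

variable (n : ℕ) (M : Type*) [TopologicalSpace M] [ChartedSpace (Cn n) M]

/-- The holomorphic charts of a complex manifold `M` of complex dimension `n`. -/
def holomorphicCharts : Set (OpenPartialHomeomorph M (Cn n)) :=
  IsManifold.maximalAtlas 𝓘(ℂ, Cn n) ω M

variable {n M}

/-- The expression, in the chart `φ`, of a field `g` of real-valued functions of two tangent
vectors: `(z, u, v) ↦ g(d(φ⁻¹)_z u, d(φ⁻¹)_z v)`. -/
def inChart
    (g : ∀ x : M, TangentSpace 𝓘(ℂ, Cn n) x → TangentSpace 𝓘(ℂ, Cn n) x → ℝ)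
    (φ : OpenPartialHomeomorph M (Cn n)) (z u v : Cn n) : ℝ :=
  g (φ.symm z) (mfderiv 𝓘(ℂ, Cn n) 𝓘(ℂ, Cn n) φ.symm z u)
    (mfderiv 𝓘(ℂ, Cn n) 𝓘(ℂ, Cn n) φ.symm z v)

variable (n M)

/-- A (smooth) Hermitian metric on a complex manifold: a Riemannian metric `g` with
`g(JX, JY) = g(X, Y)`. Smoothness means that in every holomorphic chart the coefficients are
smooth functions (in the real sense). -/
structure HermitianMetric where
  /-- The metric at a point, as a real bilinear form on the tangent space. -/
  toBilin : ∀ x : M, TangentSpace 𝓘(ℂ, Cn n) x →ₗ[ℝ] TangentSpace 𝓘(ℂ, Cn n) x →ₗ[ℝ] ℝ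
  symm : ∀ (x : M) (u v : TangentSpace 𝓘(ℂ, Cn n) x), toBilin x u v = toBilin x v u
  pos : ∀ (x : M) (u : TangentSpace 𝓘(ℂ, Cn n) x), u ≠ 0 → 0 < toBilin x u u
  hermitian : ∀ (x : M) (u v : TangentSpace 𝓘(ℂ, Cn n) x),
    toBilin x (Complex.I • u) (Complex.I • v) = toBilin x u v
  smooth : ∀ φ ∈ holomorphicCharts n M, ∀ u v : Cn n,
    ContDiffOn ℝ ∞ (fun z => inChart (fun x a b => toBilin x a b) φ z u v) φ.target

variable {n M}

/-- The coordinate expression of a Hermitian metric in a chart. -/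
def HermitianMetric.local (g : HermitianMetric n M) (φ : OpenPartialHomeomorph M (Cn n)) :
    Cn n → Cn n → Cn n → ℝ :=
  inChart (fun x a b => g.toBilin x a b) φ

/-- `ω` is `k`-Gauduchon if `√-1 ∂∂̄ωᵏ ∧ ω^{n-k-1} = 0` on `M`, i.e. at every point of every
holomorphic chart. -/
def HermitianMetric.IsKGauduchon (g : HermitianMetric n M) (k : ℕ) : Prop :=
  ∀ φ ∈ holomorphicCharts n M, ∀ z ∈ φ.target,
    wedge (iDelDelbarOmegaPow (g.local φ) k z) (omegaPow (g.local φ) (n - k - 1) z) = 0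

end Global

end HermitianGeometry

end

noncomputable section

namespace HermitianGeometry

section

/-! ### The exterior algebra on the covectors `dzⁱ`, `dz̄ⁱ` -/

/-! The statement is pointwise in each holomorphic chart, and at a point it becomes algebra in the
exterior algebra on the `dzⁱ` and `dz̄ⁱ`. There `ω` is the central element `Om h`. The map `toForm`
carries products to wedge products (`wedge_toForm`), contractions to `ι`, and hence `extLam` to `Λ`.
No unitary frame is chosen: all traces are taken with a general inverse matrix `h^{ij̄}`.

The equivalence of 1 and 2 is linear algebra. On forms of degree `p` one has `[Λ, ω ∧ ·] = n - p`
(`extLam_Om_mul`). If `x` has degree `2p` and `p + m = n`, then `ω^{m+1} ∧ x = 0` for degree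
reasons, and applying `Λ` makes `ω^m ∧ x` a nonzero multiple of `ω^{m+1} ∧ Λx`. Iterating, `ω^m ∧ x`
is a nonzero multiple of `(Λ^p x) ωⁿ` (`exists_Om_pow_mul_eq`). Take `p = k + 1`, and note that `ωⁿ`
is nonzero because `Λⁿωⁿ = (n!)²`.

For the equivalence of 1 and 3, the Leibniz rule gives `√-1 ∂∂̄ω^k ∧ ω^{n-k-1} = k (√-1 ∂∂̄ω ∧
ω^{n-2} + (k-1) √-1 ∂ω ∧ ∂̄ω ∧ ω^{n-3})`. Products of two or three `(1,1)`-forms with a power of `ω`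
are evaluated by 2×2 and 3×3 minors of `h^{ij̄}` (`top_two`, `top_three`). The first term is then `T
ωⁿ / (n(n-1))` with `T` = `ddbTrace`, and, apart from its factor `k - 1`, the second is `(|∂*ω|² -
|∂ω|²) ωⁿ / (n(n-1)(n-2))` (`sum_ww_mul_Om_mul_Om`). The coordinate formula for the Chern curvature
gives `s - ŝ = |∂ω|² - T` (`chernScalar_sub`). So 1 says `(n-2) T + (k-1)(|∂*ω|² - |∂ω|²) = 0`, and
eliminating `T` yields 3. -/

/-- Coefficients of complex covectors in the frame `dz¹, …, dzⁿ, dz̄¹, …, dz̄ⁿ`. -/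
abbrev Cov (n : ℕ) : Type := Fin n ⊕ Fin n → ℂ

/-- The exterior algebra on complex covectors. -/
abbrev Ext (n : ℕ) : Type := ExteriorAlgebra ℂ (Cov n)

/-- The generators of the exterior algebra. -/
def gen {n : ℕ} (A : Fin n ⊕ Fin n) : Ext n := ExteriorAlgebra.ι ℂ (Pi.single A 1)

/-- Contraction of an element of the exterior algebra by a complex vector. -/
def ct {n : ℕ} : Module.Dual ℂ (Cov n) →ₗ[ℂ] Ext n →ₗ[ℂ] Ext n :=
  CliffordAlgebra.contractLeft

/-- The vectors dual to the generators. -/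
def dualVec {n : ℕ} (A : Fin n ⊕ Fin n) : Module.Dual ℂ (Cov n) := LinearMap.proj A

variable {n : ℕ}

theorem dualVec_single (A B : Fin n ⊕ Fin n) :
    dualVec A (Pi.single B 1) = if A = B then 1 else 0 := by
  simp [dualVec, Pi.single_apply]

theorem ct_ι_mul (d : Module.Dual ℂ (Cov n)) (a : Cov n) (x : Ext n) :
    ct d (ExteriorAlgebra.ι ℂ a * x) = d a • x - ExteriorAlgebra.ι ℂ a * ct d x :=
  CliffordAlgebra.contractLeft_ι_mul d a x

theorem ct_gen_mul (d : Module.Dual ℂ (Cov n)) (A : Fin n ⊕ Fin n) (x : Ext n) :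
    ct d (gen A * x) = d (Pi.single A 1) • x - gen A * ct d x :=
  ct_ι_mul d _ x

@[simp] theorem ct_one (d : Module.Dual ℂ (Cov n)) : ct d (1 : Ext n) = 0 :=
  CliffordAlgebra.contractLeft_one _ d

theorem ct_ct (d : Module.Dual ℂ (Cov n)) (x : Ext n) : ct d (ct d x) = 0 :=
  CliffordAlgebra.contractLeft_contractLeft d x

theorem gen_mul_gen (A B : Fin n ⊕ Fin n) : gen A * gen B = -(gen B * gen A) :=
  eq_neg_of_add_eq_zero_left (ExteriorAlgebra.ι_add_mul_swap _ _)

theorem ct_gen (d : Module.Dual ℂ (Cov n)) (A : Fin n ⊕ Fin n) :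
    ct d (gen A) = d (Pi.single A 1) • (1 : Ext n) := by
  simpa using ct_gen_mul d A 1

theorem ι_eq_sum (a : Cov n) : ExteriorAlgebra.ι ℂ a = ∑ A, a A • (gen A : Ext n) := by
  conv_lhs => rw [pi_eq_sum_univ' a]
  simp only [map_sum, gen, map_smul]

/-! ### Grading -/

theorem one_mem_ext : (1 : Ext n) ∈ ⋀[ℂ]^0 (Cov n) := SetLike.GradedOne.one_mem

theorem ι_mem_ext (a : Cov n) : ExteriorAlgebra.ι ℂ a ∈ ⋀[ℂ]^1 (Cov n) := by
  change _ ∈ LinearMap.range (ExteriorAlgebra.ι ℂ (M := Cov n)) ^ 1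
  rw [pow_one]; exact LinearMap.mem_range_self _ a

theorem gen_mem_ext (A : Fin n ⊕ Fin n) : (gen A : Ext n) ∈ ⋀[ℂ]^1 (Cov n) := ι_mem_ext _

theorem mul_mem_ext {p q : ℕ} {x y : Ext n} (hx : x ∈ ⋀[ℂ]^p (Cov n)) (hy : y ∈ ⋀[ℂ]^q (Cov n)) :
    x * y ∈ ⋀[ℂ]^(p + q) (Cov n) :=
  SetLike.GradedMul.mul_mem hx hy

/-- Induction on homogeneous elements. -/
theorem ext_induction {p : ℕ} {P : Ext n → Prop}
    (mon : ∀ a : Fin p → Cov n, P (ExteriorAlgebra.ιMulti ℂ p a)) (zero : P 0)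
    (add : ∀ x y, P x → P y → P (x + y)) (smul : ∀ (c : ℂ) x, P x → P (c • x))
    {x : Ext n} (hx : x ∈ ⋀[ℂ]^p (Cov n)) : P x := by
  rw [← ExteriorAlgebra.ιMulti_span_fixedDegree] at hx
  induction hx using Submodule.span_induction with
  | mem x h => obtain ⟨a, rfl⟩ := h; exact mon a
  | zero => exact zero
  | add x y _ _ hx hy => exact add x y hx hy
  | smul c x _ hx => exact smul c x hx

theorem ιMulti_mem_ext {p : ℕ} (a : Fin p → Cov n) :
    ExteriorAlgebra.ιMulti ℂ p a ∈ ⋀[ℂ]^p (Cov n) := by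
  rw [← ExteriorAlgebra.ιMulti_span_fixedDegree]
  exact Submodule.subset_span ⟨a, rfl⟩

/-- Induction on homogeneous elements through left multiplication by covectors. -/
theorem ext_left_induction {P : (p : ℕ) → Ext n → Prop} (one : P 0 1)
    (mul : ∀ (p : ℕ) (a : Cov n) (x : Ext n), x ∈ ⋀[ℂ]^p (Cov n) → P p x →
      P (p + 1) (ExteriorAlgebra.ι ℂ a * x))
    (zero : ∀ p, P p 0) (add : ∀ p x y, P p x → P p y → P p (x + y))
    (smul : ∀ p (c : ℂ) x, P p x → P p (c • x))
    {p : ℕ} {x : Ext n} (hx : x ∈ ⋀[ℂ]^p (Cov n)) : P p x := by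
  refine ext_induction (fun a => ?_) (zero p) (add p) (smul p) hx
  clear hx
  induction p with
  | zero => simpa using one
  | succ p ih =>
    rw [ExteriorAlgebra.ιMulti_succ_apply]
    exact mul p _ _ (ιMulti_mem_ext _) (ih _)

theorem ct_mem_ext (d : Module.Dual ℂ (Cov n)) {p : ℕ} {x : Ext n} (hx : x ∈ ⋀[ℂ]^(p + 1) (Cov n)) :
    ct d x ∈ ⋀[ℂ]^p (Cov n) := by
  -- The induction must also carry degree 0, where contraction vanishes: multiplying a scalar by a
  -- covector uses that case.
  have key : ∀ {q : ℕ} {x : Ext n}, x ∈ ⋀[ℂ]^q (Cov n) →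
      (q = 0 → ct d x = 0) ∧ ∀ p, q = p + 1 → ct d x ∈ ⋀[ℂ]^p (Cov n) := by
    intro q x hx
    refine ext_left_induction (P := fun q x =>
      (q = 0 → ct d x = 0) ∧ ∀ p, q = p + 1 → ct d x ∈ ⋀[ℂ]^p (Cov n)) ?_ ?_ ?_ ?_ ?_ hx
    · simp
    · rintro p a x hx ⟨h0, h1⟩
      refine ⟨by simp, ?_⟩
      rintro r hr
      obtain rfl : p = r := by omega
      rw [ct_ι_mul]
      refine Submodule.sub_mem _ (Submodule.smul_mem _ _ hx) ?_
      rcases p with _ | p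
      · rw [h0 rfl, mul_zero]; exact Submodule.zero_mem _
      · have := mul_mem_ext (ι_mem_ext a) (h1 p rfl)
        rwa [add_comm 1 p] at this
    · intro p; simp
    · rintro p x y ⟨h0, h1⟩ ⟨h0', h1'⟩
      refine ⟨fun h => by rw [map_add, h0 h, h0' h, add_zero], fun r hr => ?_⟩
      rw [map_add]; exact Submodule.add_mem _ (h1 r hr) (h1' r hr)
    · rintro p c x ⟨h0, h1⟩
      refine ⟨fun h => by rw [map_smul, h0 h, smul_zero], fun r hr => ?_⟩
      rw [map_smul]; exact Submodule.smul_mem _ _ (h1 r hr)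
  exact (key hx).2 p rfl

/-- The space of covectors has dimension `2n`, so more than `2n` of them are linearly dependent. -/
theorem ext_eq_zero_of_lt {p : ℕ} (hp : 2 * n < p) {x : Ext n} (hx : x ∈ ⋀[ℂ]^p (Cov n)) :
    x = 0 := by
  refine ext_induction (P := fun x => x = 0) (fun a => ?_) rfl ?_ ?_ hx
  · refine AlternatingMap.map_linearDependent _ _ fun hli => ?_
    have := hli.fintype_card_le_finrank
    simp at this
    omega
  · rintro x y rfl rfl; simp
  · rintro c x rfl; simp

theorem mem_ext_zero {x : Ext n} (hx : x ∈ ⋀[ℂ]^0 (Cov n)) : ∃ c : ℂ, x = c • (1 : Ext n) := by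
  change _ ∈ LinearMap.range (ExteriorAlgebra.ι ℂ (M := Cov n)) ^ 0 at hx
  rw [pow_zero, Submodule.mem_one] at hx
  obtain ⟨c, rfl⟩ := hx
  exact ⟨c, Algebra.algebraMap_eq_smul_one c⟩

/-- The Euler operator is multiplication by the degree. -/
theorem euler {p : ℕ} {x : Ext n} (hx : x ∈ ⋀[ℂ]^p (Cov n)) :
    ∑ A, gen A * ct (dualVec A) x = (p : ℂ) • x := by
  refine ext_left_induction (P := fun p x => ∑ A, gen A * ct (dualVec A) x = (p : ℂ) • x)
    ?_ ?_ ?_ ?_ ?_ hx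
  · simp
  · intro p a x hx ih
    simp only [ct_ι_mul, mul_sub, mul_smul_comm, Finset.sum_sub_distrib]
    have h1 : ∑ A, dualVec A a • (gen A * x) = ExteriorAlgebra.ι ℂ a * x := by
      rw [ι_eq_sum a, Finset.sum_mul]
      simp [dualVec]
    have h2 : ∑ A, gen A * (ExteriorAlgebra.ι ℂ a * ct (dualVec A) x)
        = -(ExteriorAlgebra.ι ℂ a * ((p : ℂ) • x)) := by
      rw [← ih, Finset.mul_sum, ← Finset.sum_neg_distrib]
      refine Finset.sum_congr rfl fun A _ => ?_
      rw [← mul_assoc, ← mul_assoc, ← neg_mul]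
      congr 1
      exact eq_neg_of_add_eq_zero_left (ExteriorAlgebra.ι_add_mul_swap _ _)
    rw [h1, h2, mul_smul_comm]
    push_cast
    module
  · simp
  · intro p x y hx hy
    simp only [map_add, mul_add, Finset.sum_add_distrib, hx, hy, smul_add]
  · intro p c x hx
    simp only [map_smul, mul_smul_comm, ← Finset.smul_sum, hx]
    rw [smul_comm]

/-! ### Two-forms of type `(1,1)` -/

/-- The generator `dzⁱ`. -/
abbrev gz (i : Fin n) : Ext n := gen (Sum.inl i)

/-- The generator `dz̄ⁱ`. -/
abbrev gzb (i : Fin n) : Ext n := gen (Sum.inr i)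

/-- The element `√-1 dzⁱ ∧ dz̄ʲ`. -/
def ww (i j : Fin n) : Ext n := Complex.I • (gz i * gzb j)

theorem ww_mem (i j : Fin n) : (ww i j : Ext n) ∈ ⋀[ℂ]^2 (Cov n) :=
  Submodule.smul_mem _ _ (mul_mem_ext (gen_mem_ext _) (gen_mem_ext _))

/-- Passing a covector costs two signs, which cancel: even elements are central. -/
theorem gen_mul_gen_commute (A B : Fin n ⊕ Fin n) (x : Ext n) :
    Commute (gen A * gen B) x := by
  induction x using ExteriorAlgebra.induction with
  | algebraMap r => exact (Algebra.commutes r _).symm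
  | ι a =>
    have h (C) : gen C * ExteriorAlgebra.ι ℂ a = -(ExteriorAlgebra.ι ℂ a * gen C) :=
      eq_neg_of_add_eq_zero_left (ExteriorAlgebra.ι_add_mul_swap _ _)
    rw [Commute, SemiconjBy, mul_assoc, h, mul_neg, ← mul_assoc, h, neg_mul, neg_neg, mul_assoc]
  | mul x y hx hy => exact hx.mul_right hy
  | add x y hx hy => exact hx.add_right hy

theorem ww_commute (i j : Fin n) (x : Ext n) : Commute (ww i j) x :=
  (gen_mul_gen_commute _ _ x).smul_left _

theorem ct_ww_mul (d : Module.Dual ℂ (Cov n)) (i j : Fin n) (x : Ext n) :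
    ct d (ww i j * x) = ct d (ww i j) * x + ww i j * ct d x := by
  simp only [ww, smul_mul_assoc, map_smul, mul_assoc, ct_gen_mul, ct_gen, ← smul_add]
  congr 1
  simp only [mul_sub, sub_mul, smul_mul_assoc, mul_smul_comm, mul_one, ← mul_assoc]
  abel

theorem ct_ww (d : Module.Dual ℂ (Cov n)) (i j : Fin n) :
    ct d (ww i j) = (Complex.I * d (Pi.single (Sum.inl i) 1)) • gzb j
      - (Complex.I * d (Pi.single (Sum.inr j) 1)) • gz i := by
  simp only [ww, map_smul, ct_gen_mul, ct_gen, mul_smul_comm, mul_one, smul_sub, smul_smul]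

/-- The element `∑ h_{ij} √-1 dzⁱ ∧ dz̄ʲ`. -/
def Om (h : Fin n → Fin n → ℂ) : Ext n := ∑ i, ∑ j, h i j • ww i j

variable (h : Fin n → Fin n → ℂ)

theorem Om_mem : Om h ∈ ⋀[ℂ]^2 (Cov n) :=
  Submodule.sum_mem _ fun i _ => Submodule.sum_mem _ fun j _ => Submodule.smul_mem _ _ (ww_mem i j)

theorem Om_pow_mem (k : ℕ) : Om h ^ k ∈ ⋀[ℂ]^(2 * k) (Cov n) := by
  induction k with
  | zero => rw [pow_zero]; exact one_mem_ext
  | succ k ih => rw [pow_succ]; exact mul_mem_ext ih (Om_mem h)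

theorem Om_commute (x : Ext n) : Commute (Om h) x := by
  refine Commute.sum_left _ _ _ fun i _ => Commute.sum_left _ _ _ fun j _ => ?_
  exact (ww_commute i j x).smul_left _

theorem ct_Om_mul (d : Module.Dual ℂ (Cov n)) (x : Ext n) :
    ct d (Om h * x) = ct d (Om h) * x + Om h * ct d x := by
  simp only [Om, Finset.sum_mul, map_sum, smul_mul_assoc, map_smul, ct_ww_mul, smul_add,
    Finset.sum_add_distrib]

/-- Leibniz rule: `ω` is even and central, so contraction differentiates its powers as in the
commutative case. For `m = 0` the truncated exponent is harmless because its coefficient is zero. -/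
theorem ct_Om_pow_mul (d : Module.Dual ℂ (Cov n)) (m : ℕ) (x : Ext n) :
    ct d (Om h ^ m * x) = (m : ℂ) • (ct d (Om h) * (Om h ^ (m - 1) * x)) + Om h ^ m * ct d x := by
  induction m with
  | zero => simp
  | succ m ih =>
    rw [pow_succ', mul_assoc, ct_Om_mul, ih]
    rcases m with _ | m
    · simp
    · have := (Om_commute h (ct d (Om h))).eq
      simp only [Nat.add_sub_cancel]
      rw [mul_add, mul_smul_comm, ← mul_assoc (Om h) (ct d (Om h)), this, ← mul_assoc (Om h),
        mul_assoc, ← mul_assoc (Om h) (Om h ^ m), ← pow_succ']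
      push_cast
      module

/-! ### The operator `Λ` and its commutator with multiplication by `ω` -/

/-- The operator `Λ = √-1 hⁱʲ ι_i ι_j̄` on the exterior algebra. -/
def extLam (k : Fin n → Fin n → ℂ) : Ext n →ₗ[ℂ] Ext n :=
  Complex.I • ∑ i, ∑ j, k i j • ct (dualVec (Sum.inl i)) ∘ₗ ct (dualVec (Sum.inr j))

variable (k : Fin n → Fin n → ℂ)

theorem extLam_apply (x : Ext n) : extLam k x = Complex.I • ∑ i, ∑ j, k i j •
    ct (dualVec (Sum.inl i)) (ct (dualVec (Sum.inr j)) x) := by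
  simp [extLam, LinearMap.sum_apply]

theorem extLam_mem {p : ℕ} {x : Ext n} (hx : x ∈ ⋀[ℂ]^(p + 2) (Cov n)) :
    extLam k x ∈ ⋀[ℂ]^p (Cov n) := by
  rw [extLam_apply]
  exact Submodule.smul_mem _ _ (Submodule.sum_mem _ fun i _ => Submodule.sum_mem _ fun j _ =>
    Submodule.smul_mem _ _ (ct_mem_ext _ (ct_mem_ext _ hx)))

theorem ct_inl_Om (i : Fin n) :
    ct (dualVec (Sum.inl i)) (Om h) = ∑ j, (Complex.I * h i j) • gzb j := by
  simp only [Om, map_sum, map_smul, ct_ww, dualVec_single]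
  rw [Finset.sum_eq_single i]
  · simp [smul_smul, mul_comm]
  · intro b _ hb; simp [hb.symm]
  · simp

theorem ct_inr_Om (j : Fin n) :
    ct (dualVec (Sum.inr j)) (Om h) = -∑ i, (Complex.I * h i j) • gz i := by
  simp only [Om, map_sum, map_smul, ct_ww, dualVec_single, ← Finset.sum_neg_distrib]
  refine Finset.sum_congr rfl fun i _ => ?_
  rw [Finset.sum_eq_single j]
  · simp [smul_smul, mul_comm]
  · intro b _ hb; simp [hb.symm]
  · simp

/-- `h` and `k` are transposed inverses of each other. -/
structure IsInv (h k : Fin n → Fin n → ℂ) : Prop where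
  right : ∀ i l, ∑ j, k i j * h l j = if i = l then 1 else 0
  left : ∀ j l, ∑ i, k i j * h i l = if j = l then 1 else 0

variable {h k}

/-- Contracting twice through `ω` leaves a full trace, equal to `n`, and two cross terms. By
inversion of `h` the cross terms add up to minus the Euler operator, which is `-p` by `euler`. -/
theorem extLam_Om_mul (hk : IsInv h k) {p : ℕ} {x : Ext n} (hx : x ∈ ⋀[ℂ]^p (Cov n)) :
    extLam k (Om h * x) = Om h * extLam k x + ((n : ℂ) - p) • x := by
  have I2 : Complex.I * Complex.I = -1 := Complex.I_mul_I
  have e1 (i j : Fin n) : ct (dualVec (Sum.inl i)) (ct (dualVec (Sum.inr j)) (Om h * x)) =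
      (-(Complex.I * h i j)) • x
      + ∑ l, (Complex.I * h l j) • (gz l * ct (dualVec (Sum.inl i)) x)
      + ∑ l, (Complex.I * h i l) • (gzb l * ct (dualVec (Sum.inr j)) x)
      + Om h * ct (dualVec (Sum.inl i)) (ct (dualVec (Sum.inr j)) x) := by
    rw [ct_Om_mul, map_add, ct_Om_mul, ct_inl_Om, ct_inr_Om, neg_mul, Finset.sum_mul]
    simp only [smul_mul_assoc, map_neg, map_sum, map_smul, ct_gen_mul, dualVec_single,
      Finset.sum_mul, smul_sub, Finset.sum_sub_distrib]
    have : ∑ l, (Complex.I * h l j) • (if (Sum.inl i : Fin n ⊕ Fin n) = Sum.inl l then (1:ℂ) else 0) • x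
        = (Complex.I * h i j) • x := by
      rw [Finset.sum_eq_single i]
      · simp
      · intro b _ hb; simp [hb.symm]
      · simp
    rw [this, neg_smul]
    abel
  rw [extLam_apply, extLam_apply]
  simp only [e1, smul_add, Finset.sum_add_distrib]
  have t1 : Complex.I • ∑ i, ∑ j, k i j • (-(Complex.I * h i j)) • x = (n : ℂ) • x := by
    simp only [smul_smul, ← Finset.sum_smul]
    congr 1
    have : ∀ i, ∑ j, k i j * -(Complex.I * h i j) = -Complex.I := by
      intro i
      have := hk.right i i
      simp only [if_true] at this
      calc _ = -Complex.I * ∑ j, k i j * h i j := by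
            rw [Finset.mul_sum]; exact Finset.sum_congr rfl fun j _ => by ring
        _ = _ := by rw [this, mul_one]
    simp only [this, Finset.sum_const, Finset.card_univ, Fintype.card_fin, nsmul_eq_mul]
    linear_combination -(n : ℂ) * I2
  have t2 : Complex.I • ∑ i, ∑ j, k i j • ∑ l, (Complex.I * h l j) •
      (gz l * ct (dualVec (Sum.inl i)) x) = -∑ i, gz i * ct (dualVec (Sum.inl i)) x := by
    rw [Finset.smul_sum, ← Finset.sum_neg_distrib]
    refine Finset.sum_congr rfl fun i _ => ?_
    simp only [Finset.smul_sum, smul_smul]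
    rw [Finset.sum_comm]
    simp only [← Finset.sum_smul]
    have : ∀ l, ∑ j, Complex.I * (k i j * (Complex.I * h l j)) = if i = l then -1 else 0 := by
      intro l
      calc _ = (Complex.I * Complex.I) * ∑ j, k i j * h l j := by
            rw [Finset.mul_sum]; exact Finset.sum_congr rfl fun j _ => by ring
        _ = _ := by rw [hk.right, I2]; split_ifs <;> simp
    simp [this]
  have t3 : Complex.I • ∑ i, ∑ j, k i j • ∑ l, (Complex.I * h i l) •
      (gzb l * ct (dualVec (Sum.inr j)) x) = -∑ i, gzb i * ct (dualVec (Sum.inr i)) x := by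
    rw [Finset.sum_comm, Finset.smul_sum, ← Finset.sum_neg_distrib]
    refine Finset.sum_congr rfl fun j _ => ?_
    simp only [Finset.smul_sum, smul_smul]
    rw [Finset.sum_comm]
    simp only [← Finset.sum_smul]
    have : ∀ l, ∑ i, Complex.I * (k i j * (Complex.I * h i l)) = if j = l then -1 else 0 := by
      intro l
      calc _ = (Complex.I * Complex.I) * ∑ i, k i j * h i l := by
            rw [Finset.mul_sum]; exact Finset.sum_congr rfl fun j _ => by ring
        _ = _ := by rw [hk.left, I2]; split_ifs <;> simp
    simp [this]
  have eu := euler hx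
  rw [Fintype.sum_sum_type] at eu
  rw [t1, t2, t3, mul_smul_comm, Finset.mul_sum, sub_smul, ← eu]
  simp only [Finset.mul_sum, mul_smul_comm]
  abel

/-- The coefficient is the sum of `n - p - 2i` over `0 ≤ i ≤ m`, one commutator for each factor `ω`.
-/
theorem extLam_Om_pow_mul (hk : IsInv h k) {p : ℕ} {x : Ext n} (hx : x ∈ ⋀[ℂ]^p (Cov n)) (m : ℕ) :
    extLam k (Om h ^ (m + 1) * x) =
      Om h ^ (m + 1) * extLam k x + ((m + 1 : ℂ) * (n - p - m)) • (Om h ^ m * x) := by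
  induction m with
  | zero => simp [extLam_Om_mul hk hx]
  | succ m ih =>
    rw [pow_succ' _ (m + 1), mul_assoc, extLam_Om_mul hk (mul_mem_ext (Om_pow_mem h (m + 1)) hx), ih,
      mul_add, mul_smul_comm, ← mul_assoc (Om h) (Om h ^ m), ← pow_succ', mul_assoc]
    push_cast
    module

/-- Raising the power of `ω` and applying `Λ` agree in top degree. -/
theorem Om_pow_mul_of_deg (hk : IsInv h k) {p m : ℕ} (hpm : p + m = n) {x : Ext n}
    (hx : x ∈ ⋀[ℂ]^(2 * p) (Cov n)) :
    ((m + 1 : ℂ) * p) • (Om h ^ m * x) = Om h ^ (m + 1) * extLam k x := by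
  have h0 : Om h ^ (m + 1) * x = 0 :=
    ext_eq_zero_of_lt (by omega) (mul_mem_ext (Om_pow_mem h (m + 1)) hx)
  have := extLam_Om_pow_mul hk hx m
  rw [h0, map_zero] at this
  have hn : (n : ℂ) = p + m := by exact_mod_cast hpm.symm
  rw [hn] at this
  push_cast at this
  rw [eq_comm, add_eq_zero_iff_eq_neg] at this
  rw [this, ← neg_smul]
  congr 1
  ring

/-- Each step trades one `Λ` for one more factor `ω`; the constants `(m+1)p` met on the way are
nonzero. Only the nonvanishing of `c` matters later. -/
theorem exists_Om_pow_mul_eq (hk : IsInv h k) {p m : ℕ} (hpm : p + m = n) {x : Ext n}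
    (hx : x ∈ ⋀[ℂ]^(2 * p) (Cov n)) :
    ∃ c : ℂ, c ≠ 0 ∧ Om h ^ m * x = c • (Om h ^ n * (extLam k)^[p] x) := by
  induction p generalizing m x with
  | zero =>
    obtain rfl : m = n := by omega
    exact ⟨1, one_ne_zero, by simp⟩
  | succ p ih =>
    obtain ⟨c, hc, h1⟩ := ih (m := m + 1) (by omega) (extLam_mem k hx)
    have hne : (m + 1 : ℂ) * ((p + 1 : ℕ) : ℂ) ≠ 0 := by
      have : ((m + 1 : ℕ) : ℂ) ≠ 0 := Nat.cast_ne_zero.2 (by omega)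
      push_cast at this
      exact mul_ne_zero this (Nat.cast_ne_zero.2 (by omega))
    refine ⟨((m + 1 : ℂ) * ((p + 1 : ℕ) : ℂ))⁻¹ * c, mul_ne_zero (inv_ne_zero hne) hc, ?_⟩
    rw [Function.iterate_succ_apply, mul_smul, ← h1, ← Om_pow_mul_of_deg hk hpm hx, smul_smul,
      inv_mul_cancel₀ hne, one_smul]

theorem extLam_iterate_mem {p : ℕ} {x : Ext n} (hx : x ∈ ⋀[ℂ]^(2 * p) (Cov n)) :
    (extLam k)^[p] x ∈ ⋀[ℂ]^0 (Cov n) := by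
  induction p generalizing x with
  | zero => simpa using hx
  | succ p ih =>
    rw [Function.iterate_succ_apply]
    exact ih (extLam_mem k hx)

/-- Iterates `Λ ω^{m+1} = (m+1)(n-m) ω^m`. The factors `m + 1` build the descending factorial and
the factors `n - m = j + 1` build `j!`. -/
theorem extLam_iterate_Om_pow (hk : IsInv h k) (j : ℕ) (hj : j ≤ n) :
    (extLam k)^[j] (Om h ^ n) = (n.descFactorial j * j.factorial : ℂ) • Om h ^ (n - j) := by
  induction j with
  | zero => simp
  | succ j ih =>
    obtain ⟨m, hm⟩ : ∃ m, n = m + 1 + j := ⟨n - j - 1, by omega⟩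
    rw [Function.iterate_succ_apply', ih (by omega), map_smul]
    have h1 : n - j = m + 1 := by omega
    have h2 : n - (j + 1) = m := by omega
    have h3 := extLam_Om_pow_mul hk one_mem_ext m
    have h4 : extLam k (1 : Ext n) = 0 := by simp [extLam_apply]
    rw [mul_one, mul_one, h4, mul_zero, zero_add] at h3
    rw [h1, h2, h3, smul_smul, Nat.descFactorial_succ, h1, Nat.factorial_succ]
    congr 1
    rw [show ((n : ℕ) : ℂ) = m + 1 + j by exact_mod_cast hm]
    push_cast
    ring

/-! ### Products of `(1,1)`-forms in top degree -/

/-- The vector `v_j` with `ι_{v_j} ω = √-1 dz̄ʲ`. -/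
def rowVec (k : Fin n → Fin n → ℂ) (j : Fin n) : Module.Dual ℂ (Cov n) :=
  ∑ i, k i j • dualVec (Sum.inl i)

theorem rowVec_inl (j a : Fin n) : rowVec k j (Pi.single (Sum.inl a) 1) = k a j := by
  simp [rowVec, LinearMap.sum_apply, dualVec_single]

theorem rowVec_inr (j a : Fin n) : rowVec k j (Pi.single (Sum.inr a) 1) = 0 := by
  simp [rowVec, LinearMap.sum_apply, dualVec_single]

theorem ct_rowVec_Om (hk : IsInv h k) (j : Fin n) :
    ct (rowVec k j) (Om h) = Complex.I • gzb j := by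
  simp only [rowVec, map_sum, map_smul, LinearMap.sum_apply, LinearMap.smul_apply, ct_inl_Om,
    Finset.smul_sum, smul_smul]
  rw [Finset.sum_comm]
  simp only [← Finset.sum_smul]
  have : ∀ l, ∑ i, k i j * (Complex.I * h i l) = if j = l then Complex.I else 0 := by
    intro l
    calc _ = Complex.I * ∑ i, k i j * h i l := by
          rw [Finset.mul_sum]; exact Finset.sum_congr rfl fun j _ => by ring
      _ = _ := by rw [hk.left]; split_ifs <;> simp
  simp [this]

/-- The vector `u_i` with `ι_{u_i} ω = -√-1 dzⁱ`. -/
def colVec (k : Fin n → Fin n → ℂ) (i : Fin n) : Module.Dual ℂ (Cov n) :=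
  ∑ j, k i j • dualVec (Sum.inr j)

theorem colVec_inr (j a : Fin n) : colVec k j (Pi.single (Sum.inr a) 1) = k j a := by
  simp [colVec, LinearMap.sum_apply, dualVec_single]

theorem colVec_inl (j a : Fin n) : colVec k j (Pi.single (Sum.inl a) 1) = 0 := by
  simp [colVec, LinearMap.sum_apply, dualVec_single]

theorem ct_colVec_Om (hk : IsInv h k) (i : Fin n) :
    ct (colVec k i) (Om h) = -(Complex.I • gz i) := by
  simp only [colVec, map_sum, map_smul, LinearMap.sum_apply, LinearMap.smul_apply, ct_inr_Om,
    smul_neg, Finset.smul_sum, smul_smul, Finset.sum_neg_distrib]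
  rw [Finset.sum_comm]
  simp only [← Finset.sum_smul]
  have : ∀ l, ∑ j, k i j * (Complex.I * h l j) = if i = l then Complex.I else 0 := by
    intro l
    calc _ = Complex.I * ∑ j, k i j * h l j := by
          rw [Finset.mul_sum]; exact Finset.sum_congr rfl fun j _ => by ring
      _ = _ := by rw [hk.right]; split_ifs <;> simp
  simp [this]

/-- The product `ω^m ∧ x` has degree `2n + 1`, hence is zero; contracting this zero with `v_j` gives
the identity. It drives the evaluation of top-degree products: one `(1,1)`-factor is removed at each
use. -/
theorem Om_pow_mul_ct_rowVec (hk : IsInv h k) {r m : ℕ} (hr : r + m = n) {x : Ext n}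
    (hx : x ∈ ⋀[ℂ]^(2 * r + 1) (Cov n)) (j : Fin n) :
    Om h ^ m * ct (rowVec k j) x
      = -((m : ℂ) • (Complex.I • (gzb j * (Om h ^ (m - 1) * x)))) := by
  have h0 : Om h ^ m * x = 0 :=
    ext_eq_zero_of_lt (by omega) (mul_mem_ext (Om_pow_mem h m) hx)
  have := ct_Om_pow_mul h (rowVec k j) m x
  rw [h0, map_zero, ct_rowVec_Om hk, eq_comm, add_eq_zero_iff_neg_eq] at this
  rw [← this, smul_mul_assoc]

theorem gzb_mul_gz (i j : Fin n) : Complex.I • (gzb j * gz i) = -ww i j := by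
  rw [gen_mul_gen, ww, smul_neg]

theorem ct_rowVec_ww_mul (a b j : Fin n) (x : Ext n) :
    ct (rowVec k j) (ww a b * x) = (Complex.I * k a j) • (gzb b * x) + ww a b * ct (rowVec k j) x := by
  rw [ct_ww_mul, ct_ww, rowVec_inl, rowVec_inr]
  simp

theorem ct_rowVec_gz (c j : Fin n) : ct (rowVec k j) (gz c) = k c j • (1 : Ext n) := by
  rw [ct_gen, rowVec_inl]

theorem I_smul_gzb_mul_gz (b c : Fin n) (t : ℂ) (x : Ext n) :
    (Complex.I * t) • (gzb b * (gz c * x)) = -(t • (ww c b * x)) := by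
  rw [mul_comm, mul_smul, ← mul_assoc, ← smul_mul_assoc, gzb_mul_gz, neg_mul, smul_neg]

theorem top_one (hk : IsInv h k) (a b : Fin n) :
    (n : ℂ) • (Om h ^ (n - 1) * ww a b) = k a b • Om h ^ n := by
  have := Om_pow_mul_ct_rowVec hk (r := 0) (m := n) (by omega) (gen_mem_ext (Sum.inl a)) b
  rw [ct_rowVec_gz, mul_smul_comm, mul_one, ← mul_assoc, (Om_commute h (gzb b)).symm.pow_right _ |>.eq,
    mul_assoc, ← mul_smul_comm, gzb_mul_gz] at this
  rw [this]; simp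

/-- Obtained by contracting `ω^{n-1} ∧ ww a b ∧ dzᶜ = 0` with `v_d`, which reduces to `top_one`. The
result is a 2×2 minor of the inverse matrix. -/
theorem top_two (hk : IsInv h k) (hn : 2 ≤ n) (a b c d : Fin n) :
    ((n : ℂ) * (n - 1)) • (Om h ^ (n - 2) * (ww a b * ww c d))
      = (k a b * k c d - k a d * k c b) • Om h ^ n := by
  have := Om_pow_mul_ct_rowVec hk (r := 1) (m := n - 1) (by omega)
    (mul_mem_ext (ww_mem a b) (gen_mem_ext (Sum.inl c))) d
  have e : ((n - 1 : ℕ) : ℂ) = n - 1 := by push_cast [Nat.cast_sub (show 1 ≤ n by omega)]; ring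
  have c1 : gzb d * (Om h ^ (n - 1 - 1) * (ww a b * gz c)) =
      Om h ^ (n - 2) * (ww a b * (gzb d * gz c)) := by
    rw [← mul_assoc, (Om_commute h (gzb d)).symm.pow_right _ |>.eq, mul_assoc, ← mul_assoc (gzb d),
      ← (ww_commute a b (gzb d)).eq, mul_assoc, show n - 1 - 1 = n - 2 by omega]
  have c2 : (Complex.I * k a d) • (gzb b * gz c) = -(k a d • ww c b) := by
    simpa using I_smul_gzb_mul_gz (n := n) b c (k a d) 1
  rw [ct_rowVec_ww_mul, ct_rowVec_gz, c1, e, c2] at this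
  rw [← mul_smul_comm Complex.I, ← mul_smul_comm Complex.I, gzb_mul_gz] at this
  simp only [mul_neg, smul_neg, neg_neg, mul_add, mul_smul_comm, mul_one] at this
  rw [mul_smul, ← this, smul_add, smul_neg, smul_comm (n : ℂ), smul_comm (n : ℂ),
    top_one hk, top_one hk]
  module

/-- The same contraction, one factor longer, expands a 3×3 minor along its last column into the
minors of `top_two`. -/
theorem top_three (hk : IsInv h k) (hn : 3 ≤ n) (a b c d e f : Fin n) :
    ((n : ℂ) * (n - 1) * (n - 2)) • (Om h ^ (n - 3) * (ww a b * (ww c d * ww e f)))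
      = (k e f * (k a b * k c d - k a d * k c b) - k a f * (k e b * k c d - k e d * k c b)
        - k c f * (k a b * k e d - k a d * k e b)) • Om h ^ n := by
  have := Om_pow_mul_ct_rowVec hk (r := 2) (m := n - 2) (by omega)
    (mul_mem_ext (p := 2) (q := 3) (ww_mem a b)
      (mul_mem_ext (ww_mem c d) (gen_mem_ext (Sum.inl e)))) f
  have en : ((n - 2 : ℕ) : ℂ) = n - 2 := by push_cast [Nat.cast_sub (show 2 ≤ n by omega)]; ring
  have c1 : gzb f * (Om h ^ (n - 2 - 1) * (ww a b * (ww c d * gz e))) =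
      Om h ^ (n - 3) * (ww a b * (ww c d * (gzb f * gz e))) := by
    rw [← mul_assoc, (Om_commute h (gzb f)).symm.pow_right _ |>.eq, mul_assoc, ← mul_assoc (gzb f),
      ← (ww_commute a b (gzb f)).eq, mul_assoc, ← mul_assoc (gzb f),
      ← (ww_commute c d (gzb f)).eq, mul_assoc, show n - 2 - 1 = n - 3 by omega]
  have c2 : (Complex.I * k a f) • (gzb b * (ww c d * gz e)) = -(k a f • (ww e b * ww c d)) := by
    rw [(ww_commute c d (gz e)).eq, I_smul_gzb_mul_gz]
  have c3 : (Complex.I * k c f) • (gzb d * gz e) = -(k c f • ww e d) := by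
    simpa using I_smul_gzb_mul_gz (n := n) d e (k c f) 1
  rw [ct_rowVec_ww_mul, ct_rowVec_ww_mul, ct_rowVec_gz, c1, en, c2, c3] at this
  rw [← mul_smul_comm Complex.I, ← mul_smul_comm Complex.I, ← mul_smul_comm Complex.I,
    gzb_mul_gz] at this
  simp only [mul_neg, smul_neg, neg_neg, mul_add, mul_smul_comm, mul_one] at this
  rw [mul_smul, ← this]
  simp only [smul_add, smul_neg, smul_comm ((n : ℂ) * (n - 1))]
  rw [top_two hk (by omega), top_two hk (by omega), top_two hk (by omega)]
  module

end

section

variable {n : ℕ}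

/-! ### Iterated contractions -/

section Act

variable {W : Type*} [AddCommGroup W] [Module ℂ W]

/-- The action of an exterior algebra on `Ext n` by iterated contraction. -/
def act (s : W →ₗ[ℂ] Module.Dual ℂ (Cov n)) :
    ExteriorAlgebra ℂ W →ₐ[ℂ] (Module.End ℂ (Ext n))ᵐᵒᵖ :=
  ExteriorAlgebra.lift ℂ ⟨(MulOpposite.opLinearEquiv ℂ).toLinearMap ∘ₗ ct ∘ₗ s, fun m => by
    apply MulOpposite.unop_injective
    exact LinearMap.ext fun x => ct_ct (s m) x⟩

/-- The contraction operator attached to an element of an exterior algebra. -/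
def cact (s : W →ₗ[ℂ] Module.Dual ℂ (Cov n)) :
    ExteriorAlgebra ℂ W →ₗ[ℂ] Module.End ℂ (Ext n) :=
  (MulOpposite.opLinearEquiv ℂ).symm.toLinearMap ∘ₗ (act s).toLinearMap

variable (s : W →ₗ[ℂ] Module.Dual ℂ (Cov n))

theorem cact_one : cact s 1 = 1 := by simp [cact]

/-- The order reverses because the leftmost vector must be contracted first, matching insertion into
the first slot of a form. -/
theorem cact_mul (x y : ExteriorAlgebra ℂ W) : cact s (x * y) = cact s y * cact s x := by
  simp [cact]

theorem cact_mul_apply (x y : ExteriorAlgebra ℂ W) (X : Ext n) :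
    cact s (x * y) X = cact s y (cact s x X) := by
  rw [cact_mul]; rfl

theorem cact_ι (a : W) : cact s (ExteriorAlgebra.ι ℂ a) = ct (s a) := by
  simp [cact, act]

end Act

/-- Iterated contraction by `p` vectors. -/
def multiCt (p : ℕ) : Module.Dual ℂ (Cov n) [⋀^Fin p]→ₗ[ℂ] Module.End ℂ (Ext n) :=
  (cact LinearMap.id).compAlternatingMap (ExteriorAlgebra.ιMulti ℂ p)

theorem multiCt_zero (d : Fin 0 → Module.Dual ℂ (Cov n)) (x : Ext n) : multiCt 0 d x = x := by
  simp [multiCt, cact_one]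

theorem multiCt_succ (p : ℕ) (d : Fin (p + 1) → Module.Dual ℂ (Cov n)) (x : Ext n) :
    multiCt (p + 1) d x = multiCt p (fun i => d i.succ) (ct (d 0) x) := by
  simp only [multiCt, LinearMap.compAlternatingMap_apply, ExteriorAlgebra.ιMulti_succ_apply,
    cact_mul_apply, cact_ι]
  rfl

/-- Each vector in turn either hits the leading covector or passes it with a sign. The last term,
where no vector hits it, is killed by `eps`, which leaves Laplace expansion. -/
theorem multiCt_ι_mul (p : ℕ) (d : Fin (p + 1) → Module.Dual ℂ (Cov n)) (a : Cov n) (x : Ext n) :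
    multiCt (p + 1) d (ExteriorAlgebra.ι ℂ a * x) =
      ∑ j : Fin (p + 1), ((-1 : ℂ) ^ (j : ℕ) * d j a) • multiCt p (fun i => d (j.succAbove i)) x
        + (-1 : ℂ) ^ (p + 1) • (ExteriorAlgebra.ι ℂ a * multiCt (p + 1) d x) := by
  induction p generalizing x with
  | zero => simp [multiCt_succ, multiCt_zero, ct_ι_mul, sub_eq_add_neg]
  | succ p ih =>
    rw [multiCt_succ, ct_ι_mul, map_sub, map_smul, ih, Fin.sum_univ_succ (n := p + 1)]
    simp only [multiCt_succ (p + 1), Fin.succ_zero_eq_one, Fin.val_zero, pow_zero, one_mul,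
      Fin.succAbove_zero, Fin.val_succ, multiCt_succ p, Fin.succ_succAbove_zero,
      Fin.succ_succAbove_succ]
    rw [sub_eq_add_neg, neg_add, ← Finset.sum_neg_distrib, ← add_assoc]
    congr 1
    · congr 1
      refine Finset.sum_congr rfl fun j _ => ?_
      rw [← neg_smul]; congr 1; ring
    · rw [← neg_smul]; congr 1; ring

/-! ### Forms attached to elements of the exterior algebra -/

/-- The coordinates of a tangent vector in the frame dual to `gen`. -/
def coord (A : Fin n ⊕ Fin n) : Cn n →L[ℝ] ℂ :=
  Sum.elim (fun i => (EuclideanSpace.proj i : Cn n →L[ℂ] ℂ).restrictScalars ℝ)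
    (fun i => (Complex.conjCLE : ℂ →L[ℝ] ℂ).comp
      ((EuclideanSpace.proj i : Cn n →L[ℂ] ℂ).restrictScalars ℝ)) A

@[simp] theorem coord_inl (i : Fin n) (v : Cn n) : coord (Sum.inl i) v = v i := rfl

@[simp] theorem coord_inr (i : Fin n) (v : Cn n) : coord (Sum.inr i) v = conj (v i) := rfl

/-- A real tangent vector as a functional on complex covectors. -/
def evR (v : Cn n) : Module.Dual ℂ (Cov n) := ∑ A, coord A v • dualVec A

theorem evR_add (v w : Cn n) : evR (v + w) = evR v + evR w := by
  simp [evR, add_smul, Finset.sum_add_distrib]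

theorem evR_smul (c : ℝ) (v : Cn n) : evR (c • v) = (c : ℂ) • evR v := by
  simp [evR, Finset.smul_sum, smul_smul]

theorem evR_single (v : Cn n) (A : Fin n ⊕ Fin n) : evR v (Pi.single A 1) = coord A v := by
  simp [evR, LinearMap.sum_apply, dualVec_single, -Fintype.sum_sum_type]

/-- The degree zero component. -/
def eps : Ext n →ₗ[ℂ] ℂ := (ExteriorAlgebra.algebraMapInv (R := ℂ) (M := Cov n)).toLinearMap

@[simp] theorem eps_one : eps (1 : Ext n) = 1 := by simp [eps]

theorem eps_ι_mul (a : Cov n) (x : Ext n) : eps (ExteriorAlgebra.ι ℂ a * x) = 0 := by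
  simp [eps, ExteriorAlgebra.algebraMapInv]

theorem eps_smul_one {x : Ext n} (hx : x ∈ ⋀[ℂ]^0 (Cov n)) : x = eps x • (1 : Ext n) := by
  obtain ⟨c, rfl⟩ := mem_ext_zero hx
  simp

theorem continuous_eps_multiCt (p : ℕ) (x : Ext n) :
    Continuous fun v : Fin p → Cn n => eps (multiCt p (fun i => evR (v i)) x) := by
  induction p generalizing x with
  | zero => simp only [multiCt_zero]; exact continuous_const
  | succ p ih =>
    simp only [multiCt_succ, evR, map_sum, map_smul, LinearMap.sum_apply, LinearMap.smul_apply,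
      smul_eq_mul]
    refine continuous_finsetSum _ fun A _ => ?_
    refine Continuous.mul (by fun_prop) ?_
    have := (ih (ct (dualVec A) x)).comp
      (continuous_pi fun i : Fin p => continuous_apply (A := fun _ => Cn n) i.succ)
    simpa only [Function.comp_def, evR] using this

/-- The degree `p` form attached to an element of the exterior algebra. -/
def toForm (p : ℕ) : Ext n →ₗ[ℂ] Form n p where
  toFun x :=
    { toFun := fun v => eps (multiCt p (fun i => evR (v i)) x)
      map_update_add' := fun {inst} v i a b => by
        have h (c : Cn n) : (fun j => evR (Function.update v i c j)) =
            Function.update (fun j => evR (v j)) i (evR c) := by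
          ext1 j; by_cases hj : j = i
          · subst hj; simp
          · simp [hj]
        simp only [h, evR_add, AlternatingMap.map_update_add, LinearMap.add_apply, map_add]
      map_update_smul' := fun {inst} v i c b => by
        have h (c : Cn n) : (fun j => evR (Function.update v i c j)) =
            Function.update (fun j => evR (v j)) i (evR c) := by
          ext1 j; by_cases hj : j = i
          · subst hj; simp
          · simp [hj]
        simp only [h, evR_smul, AlternatingMap.map_update_smul, LinearMap.smul_apply, map_smul]
        simp
      map_eq_zero_of_eq' := fun v i j hv hij => by
        rw [AlternatingMap.map_eq_zero_of_eq (multiCt p) (fun i => evR (v i)) (congrArg evR hv) hij]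
        simp
      cont := continuous_eps_multiCt p x }
  map_add' x y := by
    ext v
    change eps (multiCt p (fun i => evR (v i)) (x + y)) = _
    rw [map_add, map_add]; rfl
  map_smul' c x := by
    ext v
    change eps (multiCt p (fun i => evR (v i)) (c • x)) = _
    rw [map_smul, map_smul]; rfl

theorem toForm_apply (p : ℕ) (x : Ext n) (v : Fin p → Cn n) :
    toForm p x v = eps (multiCt p (fun i => evR (v i)) x) := rfl

theorem curryLeft_toForm (p : ℕ) (x : Ext n) (u : Cn n) :
    (toForm (p + 1) x).curryLeft u = toForm p (ct (evR u) x) := by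
  ext v
  change toForm (p + 1) x (Matrix.vecCons u v) = _
  rw [toForm_apply, toForm_apply, multiCt_succ]
  simp

theorem castForm_toForm {p q : ℕ} (h : p = q) (x : Ext n) :
    castForm h (toForm p x) = toForm q x := by
  subst h; rfl

theorem contract_toForm {q : ℕ} : {p : ℕ} → (u : Fin p → Cn n) → (x : Ext n) →
    contract u (toForm (q + p) x) = toForm q (multiCt p (fun i => evR (u i)) x)
  | 0, u, x => by rw [multiCt_zero]; rfl
  | p + 1, u, x => by
    rw [contract, multiCt_succ, ← contract_toForm]
    congr 1
    exact curryLeft_toForm (q + p) x (u 0)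

theorem toForm_ι_mul (p : ℕ) (a : Cov n) (x : Ext n) (v : Fin (p + 1) → Cn n) :
    toForm (p + 1) (ExteriorAlgebra.ι ℂ a * x) v =
      ∑ j : Fin (p + 1), (-1 : ℂ) ^ (j : ℕ) * evR (v j) a * toForm p x (fun i => v (j.succAbove i)) := by
  rw [toForm_apply, multiCt_ι_mul, map_add, map_smul, eps_ι_mul, smul_zero, add_zero, map_sum]
  simp only [map_smul, smul_eq_mul, toForm_apply]

/-- Laplace expansion along the first row matches `toForm_ι_mul` term by term. -/
theorem toForm_ιMulti (p : ℕ) (a : Fin p → Cov n) (v : Fin p → Cn n) :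
    toForm p (ExteriorAlgebra.ιMulti ℂ p a) v = Matrix.det (Matrix.of fun i j => evR (v j) (a i)) := by
  induction p with
  | zero => simp [toForm_apply, multiCt_zero]
  | succ p ih =>
    rw [ExteriorAlgebra.ιMulti_succ_apply, toForm_ι_mul, Matrix.det_succ_row_zero]
    refine Finset.sum_congr rfl fun j _ => ?_
    rw [ih]
    rfl

/-! ### Wedge product and exterior derivative through the exterior algebra -/

theorem wedge_apply {p q : ℕ} (α : Form n p) (β : Form n q) (v : Fin (p + q) → Cn n) :
    wedge α β v = ((p.factorial * q.factorial : ℂ)⁻¹) * ∑ σ : Equiv.Perm (Fin (p + q)),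
      (Equiv.Perm.sign σ : ℂ) * (α (fun i => v (σ (Fin.castAdd q i))) *
        β (fun i => v (σ (Fin.natAdd p i)))) := by
  simp only [wedge, ContinuousAlternatingMap.smul_apply, smul_eq_mul]
  congr 1
  rw [ContinuousMultilinearMap.alternatization_apply_apply]
  refine Finset.sum_congr rfl fun σ _ => ?_
  rw [tensor_apply, Units.smul_def, zsmul_eq_mul]
  rfl

theorem wedge_add_left {p q : ℕ} (α α' : Form n p) (β : Form n q) :
    wedge (α + α') β = wedge α β + wedge α' β := by
  ext v
  simp only [wedge_apply, ContinuousAlternatingMap.add_apply, add_mul, mul_add,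
    Finset.sum_add_distrib]

theorem wedge_add_right {p q : ℕ} (α : Form n p) (β β' : Form n q) :
    wedge α (β + β') = wedge α β + wedge α β' := by
  ext v
  simp only [wedge_apply, ContinuousAlternatingMap.add_apply, mul_add,
    Finset.sum_add_distrib]

theorem wedge_smul_left {p q : ℕ} (c : ℂ) (α : Form n p) (β : Form n q) :
    wedge (c • α) β = c • wedge α β := by
  ext v
  simp only [wedge_apply, ContinuousAlternatingMap.smul_apply, smul_eq_mul, Finset.mul_sum]
  exact Finset.sum_congr rfl fun σ _ => by ring

theorem wedge_smul_right {p q : ℕ} (c : ℂ) (α : Form n p) (β : Form n q) :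
    wedge α (c • β) = c • wedge α β := by
  ext v
  simp only [wedge_apply, ContinuousAlternatingMap.smul_apply, smul_eq_mul, Finset.mul_sum]
  exact Finset.sum_congr rfl fun σ _ => by ring

/-- Expanding both determinants gives a sum over `(σ, τ, τ')`. The pair `(τ, τ')` is absorbed into
`σ`, so the full determinant appears `p! q!` times, which is the normalisation of `wedge`. -/
theorem wedge_toForm_ιMulti {p q : ℕ} (a : Fin p → Cov n) (b : Fin q → Cov n) :
    wedge (toForm p (ExteriorAlgebra.ιMulti ℂ p a)) (toForm q (ExteriorAlgebra.ιMulti ℂ q b)) =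
      toForm (p + q) (ExteriorAlgebra.ιMulti ℂ p a * ExteriorAlgebra.ιMulti ℂ q b) := by
  ext v
  rw [wedge_apply, ExteriorAlgebra.ιMulti_mul_ιMulti, toForm_ιMulti, ← Matrix.det_transpose,
    Matrix.det_apply']
  set S := ∑ σ : Equiv.Perm (Fin (p + q)), (Equiv.Perm.sign σ : ℂ) *
    ((∏ i, evR (v (σ (Fin.castAdd q i))) (a i)) * ∏ i, evR (v (σ (Fin.natAdd p i))) (b i)) with hS
  have key (τ : Equiv.Perm (Fin p)) (τ' : Equiv.Perm (Fin q)) :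
      ∑ σ : Equiv.Perm (Fin (p + q)), (Equiv.Perm.sign σ : ℂ) *
        (((Equiv.Perm.sign τ : ℂ) * ∏ i, evR (v (σ (Fin.castAdd q (τ i)))) (a i)) *
          ((Equiv.Perm.sign τ' : ℂ) * ∏ i, evR (v (σ (Fin.natAdd p (τ' i)))) (b i))) = S := by
    -- The block permutation `τ ⊕ τ'`; the substitution `σ ↦ σρ` removes `τ` and `τ'`, and its sign
    -- cancels theirs.
    set ρ : Equiv.Perm (Fin (p + q)) := finSumFinEquiv.permCongr (Equiv.Perm.sumCongr τ τ') with hρ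
    have hs : (Equiv.Perm.sign ρ : ℂ) = (Equiv.Perm.sign τ : ℂ) * (Equiv.Perm.sign τ' : ℂ) := by
      rw [hρ, Equiv.Perm.sign_permCongr, Equiv.Perm.sign_sumCongr]
      push_cast; rfl
    rw [hS, eq_comm, ← Equiv.sum_comp (Equiv.mulRight ρ)]
    refine Finset.sum_congr rfl fun σ _ => ?_
    have h1 (i) : ρ (Fin.castAdd q i) = Fin.castAdd q (τ i) := by
      simp [hρ, Equiv.permCongr_apply]
    have h2 (i) : ρ (Fin.natAdd p i) = Fin.natAdd p (τ' i) := by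
      simp [hρ, Equiv.permCongr_apply]
    simp only [Equiv.coe_mulRight, Equiv.Perm.mul_apply, h1, h2, Equiv.Perm.sign_mul]
    push_cast
    rw [hs]
    ring
  have expand : ∑ σ : Equiv.Perm (Fin (p + q)), (Equiv.Perm.sign σ : ℂ) *
      (toForm p (ExteriorAlgebra.ιMulti ℂ p a) (fun i => v (σ (Fin.castAdd q i))) *
        toForm q (ExteriorAlgebra.ιMulti ℂ q b) (fun i => v (σ (Fin.natAdd p i))))
      = (p.factorial * q.factorial : ℂ) * S := by
    simp only [toForm_ιMulti]
    conv_lhs =>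
      enter [2, σ, 2]
      rw [← Matrix.det_transpose, Matrix.det_apply', ← Matrix.det_transpose, Matrix.det_apply',
        Finset.sum_mul_sum]
    simp only [Finset.mul_sum, Matrix.transpose_apply, Matrix.of_apply]
    rw [Finset.sum_comm]
    have : ∀ τ : Equiv.Perm (Fin p), (∑ σ : Equiv.Perm (Fin (p + q)), ∑ τ' : Equiv.Perm (Fin q),
        (Equiv.Perm.sign σ : ℂ) *
        (((Equiv.Perm.sign τ : ℂ) * ∏ i, evR (v (σ (Fin.castAdd q (τ i)))) (a i)) *
          ((Equiv.Perm.sign τ' : ℂ) * ∏ i, evR (v (σ (Fin.natAdd p (τ' i)))) (b i))))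
        = q.factorial * S := by
      intro τ
      rw [Finset.sum_comm]
      simp only [key, Finset.sum_const, Finset.card_univ, Fintype.card_perm, Fintype.card_fin,
        nsmul_eq_mul]
    rw [Finset.sum_congr rfl fun τ _ => this τ]
    simp only [Finset.sum_const, Finset.card_univ, Fintype.card_perm, Fintype.card_fin,
        nsmul_eq_mul]
    ring
  rw [expand, ← mul_assoc, inv_mul_cancel₀, one_mul, hS]
  · refine Finset.sum_congr rfl fun σ _ => ?_
    simp [Fin.prod_univ_add]
  · exact mul_ne_zero (Nat.cast_ne_zero.2 (Nat.factorial_ne_zero _))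
      (Nat.cast_ne_zero.2 (Nat.factorial_ne_zero _))

theorem wedge_toForm {p q : ℕ} {x y : Ext n} (hx : x ∈ ⋀[ℂ]^p (Cov n)) (hy : y ∈ ⋀[ℂ]^q (Cov n)) :
    wedge (toForm p x) (toForm q y) = toForm (p + q) (x * y) := by
  have z1 (β : Form n q) : wedge (0 : Form n p) β = 0 := by
    ext v; simp [wedge_apply]
  have z2 (α : Form n p) : wedge α (0 : Form n q) = 0 := by
    ext v; simp [wedge_apply]
  refine ext_induction (P := fun x => wedge (toForm p x) (toForm q y) = toForm (p + q) (x * y))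
    (fun a => ?_) ?_ ?_ ?_ hx
  · refine ext_induction (P := fun y => wedge (toForm p (ExteriorAlgebra.ιMulti ℂ p a)) (toForm q y)
      = toForm (p + q) (ExteriorAlgebra.ιMulti ℂ p a * y))
      (fun b => wedge_toForm_ιMulti a b) ?_ ?_ ?_ hy
    · simp [z2]
    · intro x y hx hy
      rw [map_add, wedge_add_right, hx, hy, mul_add, map_add]
    · intro c x hx
      rw [map_smul, wedge_smul_right, hx, mul_smul_comm, map_smul]
  · simp [z1]
  · intro x y hx hy
    rw [map_add, wedge_add_left, hx, hy, add_mul, map_add]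
  · intro c x hx
    rw [map_smul, wedge_smul_left, hx, smul_mul_assoc, map_smul]

theorem alternatizeUncurryFin_eq_toForm {p : ℕ} (D : Cn n →L[ℝ] Form n p)
    (x : Fin n ⊕ Fin n → Ext n) (hD : ∀ v, D v = ∑ A, coord A v • toForm p (x A)) :
    ContinuousAlternatingMap.alternatizeUncurryFin D = toForm (p + 1) (∑ A, gen A * x A) := by
  ext v
  rw [ContinuousAlternatingMap.alternatizeUncurryFin_apply, map_sum,
    ContinuousAlternatingMap.sum_apply]
  simp only [hD, gen, toForm_ι_mul, evR_single]
  rw [eq_comm, Finset.sum_comm]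
  refine Finset.sum_congr rfl fun j _ => ?_
  rw [eq_comm, ContinuousAlternatingMap.sum_apply, Finset.smul_sum]
  refine Finset.sum_congr rfl fun A _ => ?_
  simp only [ContinuousAlternatingMap.smul_apply, smul_eq_mul, zsmul_eq_mul]
  push_cast
  rw [mul_assoc]
  rfl

/-! ### Complex frame and interior products -/

theorem coord_J (A : Fin n ⊕ Fin n) (v : Cn n) :
    coord A (J n v) = Sum.elim (fun _ => Complex.I) (fun _ => -Complex.I) A * coord A v := by
  rcases A with i | i <;> simp [J]

theorem coord_e (A : Fin n ⊕ Fin n) (j : Fin n) :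
    coord A (e j) = Sum.elim (fun i => if i = j then 1 else 0) (fun i => if i = j then 1 else 0) A := by
  rcases A with i | i
  · simp [e]
  · by_cases h : i = j <;> simp [e, h]

theorem evR_e (j : Fin n) : evR (e j) = dualVec (Sum.inl j) + dualVec (Sum.inr j) := by
  simp [evR, Fintype.sum_sum_type, coord_e, -coord_inl, -coord_inr]

theorem evR_Je (j : Fin n) : evR (J n (e j)) =
    Complex.I • dualVec (Sum.inl j) - Complex.I • dualVec (Sum.inr j) := by
  simp [evR, Fintype.sum_sum_type, coord_J, coord_e, -coord_inl, -coord_inr, sub_eq_add_neg]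

theorem iota_toForm (p : ℕ) (i : Fin n) (x : Ext n) :
    iota i (toForm (p + 1) x) = toForm p (ct (dualVec (Sum.inl i)) x) := by
  rw [iota, curryLeft_toForm, curryLeft_toForm, evR_e, evR_Je, ← map_smul, ← map_sub, ← map_smul]
  congr 1
  simp only [map_add, map_sub, map_smul, LinearMap.add_apply, LinearMap.sub_apply,
    LinearMap.smul_apply, smul_sub, smul_smul, Complex.I_mul_I]
  module

theorem iotabar_toForm (p : ℕ) (i : Fin n) (x : Ext n) :
    iotabar i (toForm (p + 1) x) = toForm p (ct (dualVec (Sum.inr i)) x) := by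
  rw [iotabar, curryLeft_toForm, curryLeft_toForm, evR_e, evR_Je, ← map_smul, ← map_add, ← map_smul]
  congr 1
  simp only [map_add, map_sub, map_smul, LinearMap.add_apply, LinearMap.sub_apply,
    LinearMap.smul_apply, smul_sub, smul_smul, Complex.I_mul_I]
  module

theorem dz_eq_toForm (i : Fin n) : dz i = toForm 1 (gz i) := by
  ext v
  rw [toForm_apply, multiCt_succ, multiCt_zero, ct_gen, evR_single]
  simp [dz]

theorem dzbar_eq_toForm (i : Fin n) : dzbar i = toForm 1 (gzb i) := by
  ext v
  rw [toForm_apply, multiCt_succ, multiCt_zero, ct_gen, evR_single]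
  simp [dzbar]

theorem toForm_zero_smul_one_eq_zero {c : ℂ} : toForm 0 (c • (1 : Ext n)) = 0 ↔ c = 0 := by
  constructor
  · intro h
    have := congrArg (fun η : Form n 0 => η ![]) h
    simpa [toForm_apply, multiCt_zero] using this
  · rintro rfl; simp

/-! ### `Λ` and the powers of `ω` as elements of the exterior algebra -/

variable (G : Cn n → Cn n → Cn n → ℝ)

theorem Lam_toForm (z : Cn n) (p : ℕ) (x : Ext n) :
    Lam G z (toForm (p + 2) x) = toForm p (extLam (hInv G z) x) := by
  rw [Lam, extLam_apply]
  simp only [map_smul, map_sum]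
  congr 1
  refine Finset.sum_congr rfl fun i _ => Finset.sum_congr rfl fun j _ => ?_
  rw [iotabar_toForm, iota_toForm]

theorem lamPow_toForm (z : Cn n) (j : ℕ) (x : Ext n) :
    lamPow G z j (toForm (2 * j) x) = toForm 0 ((extLam (hInv G z))^[j] x) := by
  induction j generalizing x with
  | zero => rfl
  | succ j ih =>
    rw [lamPow, Function.iterate_succ_apply, ← ih]
    congr 1
    exact Lam_toForm G z (2 * j) x

/-- The coefficients `h_{ij̄}` as a function of two indices. -/
def hf (z : Cn n) (i j : Fin n) : ℂ := hMat G z i j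

theorem fundamentalForm_eq_toForm (z : Cn n) :
    fundamentalForm G z = toForm 2 (Om (hf G z)) := by
  rw [fundamentalForm]
  simp only [Om, hf, ww, map_sum, map_smul, Finset.smul_sum]
  refine Finset.sum_congr rfl fun i _ => Finset.sum_congr rfl fun j _ => ?_
  rw [dz_eq_toForm, dzbar_eq_toForm, wedge_toForm (gen_mem_ext _) (gen_mem_ext _), smul_comm]

theorem omegaPow_eq_toForm (k : ℕ) (z : Cn n) :
    omegaPow G k z = toForm (2 * k) (Om (hf G z) ^ k) := by
  rw [omegaPow]
  induction k with
  | zero =>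
    ext v
    simp [wedgePow, toForm_apply, multiCt_zero]
  | succ k ih =>
    rw [wedgePow, ih, fundamentalForm_eq_toForm, wedge_toForm (Om_pow_mem _ _) (Om_mem _), pow_succ]
    rfl

end

section

variable {n : ℕ}

/-! ### The metric at a point -/

/-- `B` is a `J`-invariant inner product. -/
structure IsHermInner (B : Cn n → Cn n → ℝ) : Prop where
  add_left : ∀ u v w, B (u + v) w = B u w + B v w
  smul_left : ∀ (c : ℝ) u w, B (c • u) w = c * B u w
  symm : ∀ u v, B u v = B v u
  pos : ∀ u, u ≠ 0 → 0 < B u u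
  herm : ∀ u v, B (J n u) (J n v) = B u v

theorem IsHermInner.sum_left {B : Cn n → Cn n → ℝ} (hB : IsHermInner B) {ι : Type*} (s : Finset ι)
    (c : ι → ℝ) (f : ι → Cn n) (w : Cn n) :
    B (∑ a ∈ s, c a • f a) w = ∑ a ∈ s, c a * B (f a) w := by
  classical
  induction s using Finset.induction_on with
  | empty => simpa using hB.smul_left 0 0 w
  | insert a s ha ih => rw [Finset.sum_insert ha, Finset.sum_insert ha, hB.add_left, hB.smul_left, ih]

theorem IsHermInner.sum_right {B : Cn n → Cn n → ℝ} (hB : IsHermInner B) {ι : Type*} (s : Finset ι)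
    (c : ι → ℝ) (f : ι → Cn n) (w : Cn n) :
    B w (∑ a ∈ s, c a • f a) = ∑ a ∈ s, c a * B w (f a) := by
  rw [hB.symm, hB.sum_left]
  exact Finset.sum_congr rfl fun a _ => by rw [hB.symm]

theorem IsHermInner.J_left {B : Cn n → Cn n → ℝ} (hB : IsHermInner B) (u v : Cn n) :
    B (J n u) v = -B u (J n v) := by
  have h1 : J n (J n u) = (-1 : ℝ) • u := by
    ext i
    simp [J, ← mul_assoc]
  rw [← hB.herm (J n u) v, h1, hB.smul_left]
  ring

variable (G : Cn n → Cn n → Cn n → ℝ) (z : Cn n)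

/-- The Gram matrix of the real coordinate frame. -/
def gramMat : Matrix (Fin n ⊕ Fin n) (Fin n ⊕ Fin n) ℝ :=
  Matrix.of fun a b => G z (realFrame a) (realFrame b)

/-- Coordinates of the real frame in the complex frame. -/
def frameMat (n : ℕ) : Matrix (Fin n ⊕ Fin n) (Fin n ⊕ Fin n) ℂ :=
  Matrix.fromBlocks 1 1 (Complex.I • 1) (-(Complex.I • 1))

theorem frameMat_apply (a A : Fin n ⊕ Fin n) : frameMat n a A = coord A (realFrame a) := by
  rcases a with i | i <;> rcases A with j | j <;>
    simp [frameMat, realFrame, coord_J, coord_e, -coord_inl, -coord_inr, Matrix.one_apply, eq_comm]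
  split_ifs <;> simp

variable {G z}

theorem hMat_apply (hB : IsHermInner (G z)) (i j : Fin n) : hMat G z i j =
    (1 / 2 : ℂ) * (G z (e i) (e j) + Complex.I * G z (e i) (J n (e j))) := by
  rw [hMat, hB.herm, hB.J_left]
  push_cast
  ring

theorem hf_conj (hB : IsHermInner (G z)) (i j : Fin n) : conj (hf G z i j) = hf G z j i := by
  rw [hf, hf, hMat_apply hB, hMat_apply hB, hB.symm (e j) (J n (e i)), hB.J_left,
    hB.symm (e j) (e i)]
  simp only [map_mul, map_add, Complex.conj_ofReal, Complex.conj_I, map_div₀, map_one, map_ofNat]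
  push_cast
  ring

theorem realFrame_sum_eq_zero {x : Fin n ⊕ Fin n → ℝ} (hx : ∑ a, x a • realFrame a = (0 : Cn n)) :
    x = 0 := by
  ext a
  have h (i : Fin n) : ((x (Sum.inl i) : ℂ) + x (Sum.inr i) * Complex.I) = 0 := by
    have := congrArg (fun v : Cn n => v i) hx
    simpa [Fintype.sum_sum_type, realFrame, e, J, Pi.single_apply] using this
  rcases a with i | i
  · simpa using congrArg Complex.re (h i)
  · simpa using congrArg Complex.im (h i)

theorem gramMat_det_ne_zero (hB : IsHermInner (G z)) : (gramMat G z).det ≠ 0 := by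
  rw [Ne, ← Matrix.exists_mulVec_eq_zero_iff]
  rintro ⟨x, hx, h0⟩
  -- A kernel vector of the Gram matrix would give a tangent vector of length zero.
  have h1 : G z (∑ a, x a • realFrame a) (∑ a, x a • realFrame a) = 0 := by
    rw [hB.sum_left]
    refine Finset.sum_eq_zero fun a _ => ?_
    rw [hB.sum_right]
    have := congrFun h0 a
    simp only [Matrix.mulVec, dotProduct, gramMat, Matrix.of_apply, Pi.zero_apply] at this
    rw [Finset.sum_congr rfl fun b _ => mul_comm _ _, this, mul_zero]
  by_contra
  have h2 : (∑ a, x a • realFrame a : Cn n) ≠ 0 := fun h => hx (realFrame_sum_eq_zero h)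
  exact absurd h1 (hB.pos _ h2).ne'

theorem gramMat_mul_gInv (hB : IsHermInner (G z)) :
    (gramMat G z).map Complex.ofReal * (gInv G z).map Complex.ofReal = 1 := by
  have : gramMat G z * gInv G z = 1 :=
    Matrix.mul_nonsing_inv _ (isUnit_iff_ne_zero.2 (gramMat_det_ne_zero hB))
  have h2 := congrArg (fun M => M.map Complex.ofRealHom) this
  simp only [Matrix.map_mul] at h2
  exact h2.trans (Matrix.map_one _ (map_zero _) (map_one _))

/-- By `J`-invariance the bilinear extension of `g` pairs only `∂/∂zⁱ` with `∂/∂z̄ʲ`, so the complex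
Gram matrix is block antidiagonal. -/
theorem gramMat_eq (hB : IsHermInner (G z)) : (gramMat G z).map Complex.ofReal =
    frameMat n * Matrix.fromBlocks 0 (hMat G z) (hMat G z).transpose 0 * (frameMat n).transpose := by
  rw [frameMat, Matrix.fromBlocks_transpose, Matrix.fromBlocks_multiply, Matrix.fromBlocks_multiply]
  have I2 : Complex.I * Complex.I = -1 := Complex.I_mul_I
  ext a b
  rcases a with i | i <;> rcases b with j | j <;>
    simp [gramMat, realFrame, hMat_apply hB, hB.symm (e j) (e i), hB.symm (e j) (J n (e i)),
      hB.J_left (e i) (e j), hB.herm]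
  · ring
  · linear_combination (G z (e i) (J n (e j)) : ℂ) * I2
  · linear_combination (-(G z (e i) (J n (e j)) : ℂ)) * I2
  · linear_combination (G z (e i) (e j) : ℂ) * I2

/-- The inverse metric in the complex frame. -/
def coMat (G : Cn n → Cn n → Cn n → ℝ) (z : Cn n) : Matrix (Fin n ⊕ Fin n) (Fin n ⊕ Fin n) ℂ :=
  (frameMat n).transpose * (gInv G z).map Complex.ofReal * frameMat n

theorem fromBlocks_mul_coMat (hB : IsHermInner (G z)) :
    Matrix.fromBlocks 0 (hMat G z) (hMat G z).transpose 0 * coMat G z = 1 := by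
  have h1 := gramMat_mul_gInv hB
  -- One-sided inverses of square matrices are two-sided, so the leading `frameMat` moves cyclically
  -- to the right end.
  rw [gramMat_eq hB, Matrix.mul_assoc, Matrix.mul_assoc, mul_eq_one_comm] at h1
  rw [coMat, ← h1]
  simp only [Matrix.mul_assoc]

theorem hMat_isUnit_det (hB : IsHermInner (G z)) : IsUnit (hMat G z).det := by
  have h1 := fromBlocks_mul_coMat hB
  rw [← Matrix.fromBlocks_toBlocks (coMat G z), Matrix.fromBlocks_multiply,
    ← Matrix.fromBlocks_one, Matrix.fromBlocks_inj] at h1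
  exact Matrix.isUnit_det_of_right_inverse (B := (coMat G z).toBlocks₂₁) (by simpa using h1.1)

theorem isInv_hf (hB : IsHermInner (G z)) : IsInv (hf G z) (hInv G z) where
  right i l := by
    have := congrFun (congrFun (Matrix.mul_nonsing_inv _ (hMat_isUnit_det hB)) l) i
    rw [Matrix.mul_apply, Matrix.one_apply] at this
    simp only [hf, hInv]
    rw [Finset.sum_congr rfl fun j _ => mul_comm _ _, this]
    simp only [eq_comm]
  left j l := by
    have := congrFun (congrFun (Matrix.nonsing_inv_mul _ (hMat_isUnit_det hB)) j) l
    rw [Matrix.mul_apply, Matrix.one_apply] at this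
    exact this

theorem coMat_eq (hB : IsHermInner (G z)) : coMat G z =
    Matrix.fromBlocks 0 (Matrix.of fun i j => hInv G z i j) (hMat G z)⁻¹ 0 := by
  have h1 := fromBlocks_mul_coMat hB
  have h2 : Matrix.fromBlocks 0 (Matrix.of fun i j => hInv G z i j) (hMat G z)⁻¹ 0 *
      Matrix.fromBlocks 0 (hMat G z) (hMat G z).transpose 0 = 1 := by
    have : (Matrix.of fun i j => hInv G z i j) = ((hMat G z)⁻¹).transpose := rfl
    rw [Matrix.fromBlocks_multiply, this, ← Matrix.transpose_mul,
      Matrix.mul_nonsing_inv _ (hMat_isUnit_det hB), Matrix.nonsing_inv_mul _ (hMat_isUnit_det hB)]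
    simp
  exact (left_inv_eq_right_inv h2 h1).symm

/-! ### Raising indices -/

/-- The real frame vectors with index raised by the metric. -/
def raise (G : Cn n → Cn n → Cn n → ℝ) (z : Cn n) (a : Fin n ⊕ Fin n) : Module.Dual ℂ (Cov n) :=
  ∑ b, (gInv G z a b : ℂ) • evR (realFrame b)

/-- The vector dual to a complex covector with respect to the metric. -/
def sharp (G : Cn n → Cn n → Cn n → ℝ) (z : Cn n) : Cov n →ₗ[ℂ] Module.Dual ℂ (Cov n) :=
  ∑ a, (evR (realFrame a)).smulRight (raise G z a)

theorem sharp_apply (θ : Cov n) : sharp G z θ = ∑ a, evR (realFrame a) θ • raise G z a := by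
  simp [sharp, LinearMap.sum_apply, -Fintype.sum_sum_type]

theorem sharp_single (A : Fin n ⊕ Fin n) :
    sharp G z (Pi.single A 1) = ∑ B, coMat G z A B • dualVec B := by
  simp only [sharp_apply, evR_single, raise]
  simp only [evR, Finset.smul_sum, smul_smul, coMat,
    Matrix.mul_apply, Matrix.transpose_apply, Matrix.map_apply, frameMat_apply, Finset.sum_smul,
    Finset.sum_mul]
  rw [Finset.sum_comm' (t' := Finset.univ) (s' := fun _ => Finset.univ) (by simp)]
  rw [Finset.sum_congr rfl fun b _ => Finset.sum_comm]
  rw [Finset.sum_comm]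
  refine Finset.sum_congr rfl fun B _ => Finset.sum_congr rfl fun b _ =>
    Finset.sum_congr rfl fun a _ => ?_
  rw [mul_assoc]

theorem sharp_inl (hB : IsHermInner (G z)) (i : Fin n) :
    sharp G z (Pi.single (Sum.inl i) 1) = colVec (hInv G z) i := by
  simp [sharp_single, coMat_eq hB, colVec, Fintype.sum_sum_type]

theorem sharp_inr (hB : IsHermInner (G z)) (j : Fin n) :
    sharp G z (Pi.single (Sum.inr j) 1) = rowVec (hInv G z) j := by
  simp [sharp_single, coMat_eq hB, rowVec, Fintype.sum_sum_type, hInv]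

theorem multiCt_insertNth {p : ℕ} (j : Fin (p + 1)) (c : Module.Dual ℂ (Cov n))
    (d : Fin p → Module.Dual ℂ (Cov n)) (X : Ext n) :
    multiCt (p + 1) (j.insertNth c d) X = (-1 : ℂ) ^ (j : ℕ) • multiCt p d (ct c X) := by
  rw [AlternatingMap.map_insertNth, Matrix.vecCons, LinearMap.smul_apply, multiCt_succ,
    ← Int.cast_smul_eq_zsmul ℂ]
  push_cast
  rfl

/-- Induction on a leading covector: it may sit in any of the `p + 1` slots, and every slot
contributes the same, which turns `p!` into `(p+1)!`. The sign for moving slot `j` to the front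
occurs twice and cancels. -/
theorem sum_toForm_smul_multiCt {p : ℕ} {x : Ext n} (hx : x ∈ ⋀[ℂ]^p (Cov n)) (X : Ext n) :
    ∑ a : Fin p → Fin n ⊕ Fin n, toForm p x (fun t => realFrame (a t)) •
      multiCt p (fun t => raise G z (a t)) X = (p.factorial : ℂ) • cact (sharp G z) x X := by
  refine ext_left_induction (P := fun p x => ∀ X, ∑ a : Fin p → Fin n ⊕ Fin n,
    toForm p x (fun t => realFrame (a t)) • multiCt p (fun t => raise G z (a t)) X
      = (p.factorial : ℂ) • cact (sharp G z) x X) ?_ ?_ ?_ ?_ ?_ hx X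
  · intro X
    simp [toForm_apply, multiCt_zero, cact_one]
  · intro p θ x hx ih X
    simp only [toForm_ι_mul, Finset.sum_smul]
    rw [Finset.sum_comm]
    have key : ∀ j : Fin (p + 1), ∑ a : Fin (p + 1) → Fin n ⊕ Fin n,
        ((-1 : ℂ) ^ (j : ℕ) * evR (realFrame (a j)) θ *
          toForm p x (fun i => realFrame (a (j.succAbove i)))) •
            multiCt (p + 1) (fun t => raise G z (a t)) X
        = (p.factorial : ℂ) • cact (sharp G z) (ExteriorAlgebra.ι ℂ θ * x) X := by
      intro j
      rw [cact_mul_apply, cact_ι, ← ih, ← Equiv.sum_comp (Fin.insertNthEquiv (fun _ => Fin n ⊕ Fin n) j),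
        Fintype.sum_prod_type, Finset.sum_comm]
      refine Finset.sum_congr rfl fun a _ => ?_
      rw [sharp_apply, map_sum, LinearMap.sum_apply, map_sum, Finset.smul_sum]
      refine Finset.sum_congr rfl fun c _ => ?_
      have e1 : (fun t => raise G z ((j.insertNth c a : Fin (p + 1) → Fin n ⊕ Fin n) t)) =
          j.insertNth (raise G z c) (fun t => raise G z (a t)) := by
        ext1 t
        refine Fin.succAboveCases j ?_ (fun i => ?_) t <;> simp
      simp only [Fin.insertNthEquiv_apply, Fin.insertNth_apply_same,
        Fin.insertNth_apply_succAbove, e1, multiCt_insertNth, map_smul, LinearMap.smul_apply,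
        smul_smul]
      congr 1
      have : (-1 : ℂ) ^ (j : ℕ) * (-1) ^ (j : ℕ) = 1 := by
        rw [← mul_pow]; simp
      linear_combination (evR (realFrame c) θ * toForm p x (fun i => realFrame (a i))) * this
    rw [Finset.sum_congr rfl fun j _ => key j, Finset.sum_const, Finset.card_univ, Fintype.card_fin,
      Nat.factorial_succ, ← Nat.cast_smul_eq_nsmul ℂ, smul_smul]
    push_cast
    rfl
  · simp
  · intro p x y hx hy X
    simp only [map_add, LinearMap.add_apply, smul_add, ← hx, ← hy, ContinuousAlternatingMap.add_apply,
      add_smul, Finset.sum_add_distrib]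
  · intro p c x hx X
    simp only [map_smul, LinearMap.smul_apply, smul_comm _ c, ← hx,
      ContinuousAlternatingMap.smul_apply, smul_assoc, Finset.smul_sum]

theorem sum_sum_toForm_smul_multiCt {p : ℕ} {x : Ext n} (hx : x ∈ ⋀[ℂ]^p (Cov n)) (X : Ext n) :
    ∑ a : Fin p → Fin n ⊕ Fin n, ∑ b : Fin p → Fin n ⊕ Fin n,
      ((∏ t, (gInv G z (a t) (b t) : ℂ)) * toForm p x (fun t => realFrame (a t))) •
        multiCt p (fun t => evR (realFrame (b t))) X
      = (p.factorial : ℂ) • cact (sharp G z) x X := by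
  rw [← sum_toForm_smul_multiCt hx]
  refine Finset.sum_congr rfl fun a _ => ?_
  have h1 : multiCt p (fun t => raise G z (a t)) = ∑ b : Fin p → Fin n ⊕ Fin n,
      (∏ t, (gInv G z (a t) (b t) : ℂ)) • multiCt p (fun t => evR (realFrame (b t))) := by
    have := (multiCt (n := n) p).toMultilinearMap.map_sum
      (fun t b => (gInv G z (a t) b : ℂ) • evR (realFrame b))
    simp only [AlternatingMap.coe_multilinearMap, MultilinearMap.map_smul_univ] at this
    exact this
  rw [h1, LinearMap.sum_apply, Finset.smul_sum]
  refine Finset.sum_congr rfl fun b _ => ?_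
  rw [LinearMap.smul_apply, smul_smul, mul_comm]

/-! ### Hodge operator and inner product as contractions -/

theorem volumeForm_eq_toForm :
    volumeForm G z = toForm (2 * n) ((n.factorial : ℂ)⁻¹ • Om (hf G z) ^ n) := by
  rw [volumeForm, omegaPow_eq_toForm, map_smul]

/-- The star operator becomes contraction of the volume form by the metric dual of `x`; the `1/p!`
compensates for summing over all index tuples. -/
theorem hodge_toForm {p q : ℕ} (hpq : 2 * n = q + p) {x : Ext n} (hx : x ∈ ⋀[ℂ]^p (Cov n)) :
    hodge G z hpq (toForm p x) =
      toForm q (cact (sharp G z) x ((n.factorial : ℂ)⁻¹ • Om (hf G z) ^ n)) := by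
  have hp : (p.factorial : ℂ) ≠ 0 := Nat.cast_ne_zero.2 (Nat.factorial_ne_zero _)
  have := sum_sum_toForm_smul_multiCt (G := G) (z := z) hx ((n.factorial : ℂ)⁻¹ • Om (hf G z) ^ n)
  rw [← inv_smul_eq_iff₀ hp] at this
  rw [hodge, volumeForm_eq_toForm, castForm_toForm, ← this]
  simp only [contract_toForm, map_smul (toForm q), map_sum]

theorem formInner_toForm {p : ℕ} {x y : Ext n} (hx : x ∈ ⋀[ℂ]^p (Cov n)) (ψ : Form n p)
    (hψ : ∀ v, conj (ψ v) = toForm p y v) :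
    formInner G z (toForm p x) ψ = eps (cact (sharp G z) x y) := by
  have hp : (p.factorial : ℂ) ≠ 0 := Nat.cast_ne_zero.2 (Nat.factorial_ne_zero _)
  have := sum_sum_toForm_smul_multiCt (G := G) (z := z) hx y
  rw [← inv_smul_eq_iff₀ hp] at this
  rw [formInner, ← this]
  simp only [map_smul eps, map_sum, hψ, toForm_apply, smul_eq_mul]

theorem cact_sharp_gz (hB : IsHermInner (G z)) (i : Fin n) :
    cact (sharp G z) (gz i) = ct (colVec (hInv G z) i) :=
  (cact_ι _ _).trans (congrArg ct (sharp_inl hB i))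

theorem cact_sharp_gzb (hB : IsHermInner (G z)) (j : Fin n) :
    cact (sharp G z) (gzb j) = ct (rowVec (hInv G z) j) :=
  (cact_ι _ _).trans (congrArg ct (sharp_inr hB j))

theorem cact_sharp_ww (hB : IsHermInner (G z)) (i j : Fin n) (X : Ext n) :
    cact (sharp G z) (ww i j) X =
      Complex.I • ct (rowVec (hInv G z) j) (ct (colVec (hInv G z) i) X) := by
  rw [ww, map_smul, LinearMap.smul_apply, cact_mul_apply, cact_sharp_gz hB, cact_sharp_gzb hB]

/-- `Λ` is contraction by the metric dual of `ω`. This lets powers of `ω` inside a Hodge star be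
computed through powers of `Λ`. -/
theorem cact_sharp_Om (hB : IsHermInner (G z)) :
    cact (sharp G z) (Om (hf G z)) = extLam (hInv G z) := by
  refine LinearMap.ext fun X => ?_
  have h1 (j : Fin n) : ∑ i, hf G z i j • colVec (hInv G z) i = dualVec (Sum.inr j) := by
    simp only [colVec, Finset.smul_sum, smul_smul]
    rw [Finset.sum_comm]
    simp only [← Finset.sum_smul, mul_comm (hf G z _ _), (isInv_hf hB).left]
    simp
  rw [Om, Finset.sum_comm, map_sum, LinearMap.sum_apply, extLam_apply, Finset.sum_comm,
    Finset.smul_sum]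
  refine Finset.sum_congr rfl fun j _ => ?_
  rw [map_sum, LinearMap.sum_apply]
  simp only [map_smul, LinearMap.smul_apply, cact_sharp_ww hB, smul_comm _ Complex.I]
  rw [← Finset.smul_sum]
  congr 1
  rw [← h1 j]
  simp only [rowVec, map_sum, map_smul, LinearMap.sum_apply, LinearMap.smul_apply, Finset.smul_sum]
  rw [Finset.sum_comm]
  simp only [smul_comm (hf G z _ _)]

theorem cact_sharp_Om_pow_mul (hB : IsHermInner (G z)) (m : ℕ) (x X : Ext n) :
    cact (sharp G z) (Om (hf G z) ^ m * x) X =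
      cact (sharp G z) x ((extLam (hInv G z))^[m] X) := by
  induction m generalizing X with
  | zero => simp
  | succ m ih =>
    rw [pow_succ', mul_assoc, cact_mul_apply, ih, cact_sharp_Om hB, Function.iterate_succ_apply]

end

section

variable {n : ℕ}

/-! ### Differentiating families in the exterior algebra -/

/-- `D` is the derivative at `z` of the family `X` of elements of the exterior algebra. -/
def HasExtDeriv (X D : Cn n → Ext n) (z : Cn n) : Prop :=
  ∀ (p : ℕ) (y : Ext n), ∃ L : Cn n →L[ℝ] Form n p, (∀ v, L v = toForm p (D v * y)) ∧
    HasFDerivAt (fun w => toForm p (X w * y)) L z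

namespace HasExtDeriv

variable {X D X' D' : Cn n → Ext n} {z : Cn n}

theorem const (x : Ext n) (z : Cn n) : HasExtDeriv (fun _ => x) (fun _ => 0) z := fun p y =>
  ⟨0, by simp, hasFDerivAt_const _ _⟩

theorem add (h : HasExtDeriv X D z) (h' : HasExtDeriv X' D' z) :
    HasExtDeriv (fun w => X w + X' w) (fun v => D v + D' v) z := fun p y => by
  obtain ⟨L, hL, hd⟩ := h p y
  obtain ⟨L', hL', hd'⟩ := h' p y
  refine ⟨L + L', fun v => by simp [hL, hL', add_mul], ?_⟩
  simpa only [add_mul, map_add] using! hd.add hd'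

theorem sum {ι : Type*} (s : Finset ι) {X D : ι → Cn n → Ext n}
    (h : ∀ i, HasExtDeriv (X i) (D i) z) :
    HasExtDeriv (fun w => ∑ i ∈ s, X i w) (fun v => ∑ i ∈ s, D i v) z := by
  classical
  induction s using Finset.induction_on with
  | empty => simpa using const 0 z
  | insert a s ha ih =>
    simp only [Finset.sum_insert ha]
    exact (h a).add ih

theorem smul {f : Cn n → ℂ} {f' : Cn n →L[ℝ] ℂ} (hf : HasFDerivAt f f' z) (h : HasExtDeriv X D z) :
    HasExtDeriv (fun w => f w • X w) (fun v => f z • D v + f' v • X z) z := fun p y => by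
  obtain ⟨L, hL, hd⟩ := h p y
  refine ⟨f z • L + f'.smulRight (toForm p (X z * y)), fun v => ?_, ?_⟩
  · simp [hL, add_mul]
  · simpa only [smul_mul_assoc, map_smul] using! hf.smul hd

/-- Immediate because `HasExtDeriv` quantifies over a right factor `y`. Testing through `toForm`
also avoids putting a topology on the exterior algebra. -/
theorem mul_const (h : HasExtDeriv X D z) (c : Ext n) :
    HasExtDeriv (fun w => X w * c) (fun v => D v * c) z := fun p y => by
  obtain ⟨L, hL, hd⟩ := h p (c * y)
  exact ⟨L, fun v => by rw [hL, mul_assoc], by simpa only [mul_assoc] using hd⟩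

theorem const_smul (h : HasExtDeriv X D z) (c : ℂ) :
    HasExtDeriv (fun w => c • X w) (fun v => c • D v) z := by
  simpa using h.smul (hasFDerivAt_const c z)

theorem congr_deriv (h : HasExtDeriv X D z) (hD : ∀ v, D v = D' v) : HasExtDeriv X D' z := by
  rwa [← funext hD]

theorem congr_fun (h : HasExtDeriv X D z) (hX : ∀ v, X v = X' v) : HasExtDeriv X' D z := by
  rwa [← funext hX]

theorem mul_Om {F : Cn n → Fin n → Fin n → ℂ} {F' : Fin n → Fin n → Cn n →L[ℝ] ℂ}
    (h : HasExtDeriv X D z) (hF : ∀ i j, HasFDerivAt (fun w => F w i j) (F' i j) z) :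
    HasExtDeriv (fun w => X w * Om (F w))
      (fun v => D v * Om (F z) + X z * Om (fun i j => F' i j v)) z := by
  have h1 : HasExtDeriv (fun w => ∑ i, ∑ j, F w i j • (X w * ww i j))
      (fun v => ∑ i, ∑ j, (F z i j • (D v * ww i j) + F' i j v • (X z * ww i j))) z :=
    sum _ fun i => sum _ fun j => (h.mul_const (ww i j)).smul (hF i j)
  refine (h1.congr_deriv fun v => ?_).congr_fun fun w => ?_
  · simp only [Om, Finset.mul_sum, mul_smul_comm, Finset.sum_add_distrib]
  · simp only [Om, Finset.mul_sum, mul_smul_comm]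

theorem Om_pow {F : Cn n → Fin n → Fin n → ℂ} {F' : Fin n → Fin n → Cn n →L[ℝ] ℂ}
    (hF : ∀ i j, HasFDerivAt (fun w => F w i j) (F' i j) z) (m : ℕ) :
    HasExtDeriv (fun w => Om (F w) ^ m)
      (fun v => (m : ℂ) • (Om (F z) ^ (m - 1) * Om (fun i j => F' i j v))) z := by
  induction m with
  | zero => simpa using const 1 z
  | succ m ih =>
    refine ((ih.mul_Om hF).congr_deriv fun v => ?_).congr_fun fun w => (pow_succ _ _).symm
    rcases m with _ | m
    · simp
    · simp only [Nat.add_sub_cancel, smul_mul_assoc]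
      rw [mul_assoc, (Om_commute (fun i j => F' i j v) (Om (F z))).eq, ← mul_assoc, ← pow_succ]
      push_cast
      module

end HasExtDeriv

/-- The component along `∂/∂zᵃ`. -/
def zPart (D : Cn n → Ext n) (a : Fin n) : Ext n :=
  (1 / 2 : ℂ) • (D (e a) - Complex.I • D (J n (e a)))

/-- The component along `∂/∂z̄ᵃ`. -/
def zbarPart (D : Cn n → Ext n) (a : Fin n) : Ext n :=
  (1 / 2 : ℂ) • (D (e a) + Complex.I • D (J n (e a)))

theorem eq_sum_realFrame (v : Cn n) :
    v = ∑ i, ((v i).re • e i + (v i).im • J n (e i)) := by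
  ext j
  simp [J, e, Pi.single_apply, Finset.sum_add_distrib]

theorem J_eq_sum_realFrame (v : Cn n) :
    J n v = ∑ i, ((v i).re • J n (e i) - (v i).im • e i) := by
  ext j
  simp [J, e, Pi.single_apply, Finset.sum_sub_distrib]
  apply Complex.ext <;> simp

theorem ofReal_smul_form {p : ℕ} (r : ℝ) (η : Form n p) : r • η = (r : ℂ) • η := by
  ext v; simp

theorem linPart_apply {p : ℕ} (L : Cn n →L[ℝ] Form n p) (v : Cn n) : linPart L v =
    ∑ a, v a • ((1 / 2 : ℂ) • (L (e a) - Complex.I • L (J n (e a)))) := by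
  have h1 : L v = ∑ i, (((v i).re : ℂ) • L (e i) + ((v i).im : ℂ) • L (J n (e i))) := by
    conv_lhs => rw [eq_sum_realFrame v]
    simp only [map_sum, map_add, map_smul, ofReal_smul_form]
  have h2 : L (J n v) = ∑ i, (((v i).re : ℂ) • L (J n (e i)) - ((v i).im : ℂ) • L (e i)) := by
    rw [J_eq_sum_realFrame v]
    simp only [map_sum, map_sub, map_smul, ofReal_smul_form]
  change (1 / 2 : ℂ) • (L v - Complex.I • L (J n v)) = _
  rw [h1, h2, Finset.smul_sum, ← Finset.sum_sub_distrib, Finset.smul_sum]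
  refine Finset.sum_congr rfl fun i _ => ?_
  conv_rhs => rw [← Complex.re_add_im (v i)]
  have I2 : Complex.I * Complex.I = -1 := Complex.I_mul_I
  match_scalars
  · ring
  · linear_combination (1 / 2 * (v i).im : ℂ) * I2

theorem antilinPart_apply {p : ℕ} (L : Cn n →L[ℝ] Form n p) (v : Cn n) : antilinPart L v =
    ∑ a, conj (v a) • ((1 / 2 : ℂ) • (L (e a) + Complex.I • L (J n (e a)))) := by
  have h1 : L v = ∑ i, (((v i).re : ℂ) • L (e i) + ((v i).im : ℂ) • L (J n (e i))) := by
    conv_lhs => rw [eq_sum_realFrame v]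
    simp only [map_sum, map_add, map_smul, ofReal_smul_form]
  have h2 : L (J n v) = ∑ i, (((v i).re : ℂ) • L (J n (e i)) - ((v i).im : ℂ) • L (e i)) := by
    rw [J_eq_sum_realFrame v]
    simp only [map_sum, map_sub, map_smul, ofReal_smul_form]
  change (1 / 2 : ℂ) • (L v + Complex.I • L (J n v)) = _
  rw [h1, h2, Finset.smul_sum, ← Finset.sum_add_distrib, Finset.smul_sum]
  refine Finset.sum_congr rfl fun i _ => ?_
  conv_rhs => rw [← Complex.re_add_im (v i)]
  have I2 : Complex.I * Complex.I = -1 := Complex.I_mul_I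
  simp only [map_add, map_mul, Complex.conj_ofReal, Complex.conj_I]
  match_scalars
  · ring
  · linear_combination (1 / 2 * (v i).im : ℂ) * I2

/-- Only the germ of `η` at `z` matters, so a local expression of `η` on an open set suffices. -/
theorem del_eq_toForm {p : ℕ} {η : Cn n → Form n p} {X D : Cn n → Ext n} {z : Cn n}
    (hη : η =ᶠ[nhds z] fun w => toForm p (X w)) (h : HasExtDeriv X D z) :
    del η z = toForm (p + 1) (∑ a, gz a * zPart D a) := by
  obtain ⟨L, hL, hd⟩ := h p 1
  simp only [mul_one] at hL hd
  rw [del, hη.fderiv_eq, hd.fderiv,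
    alternatizeUncurryFin_eq_toForm _ (Sum.elim (zPart D) fun _ => 0)]
  · simp [Fintype.sum_sum_type]
  · intro v
    have h0 (c : ℂ) : c • toForm p (0 : Ext n) = 0 := by rw [← map_smul, smul_zero, map_zero]
    simp only [linPart_apply, hL, Fintype.sum_sum_type, zPart, Sum.elim_inl, Sum.elim_inr, h0,
      Finset.sum_const_zero, add_zero, coord_inl, map_smul, map_sub]

theorem delbar_eq_toForm {p : ℕ} {η : Cn n → Form n p} {X D : Cn n → Ext n} {z : Cn n}
    (hη : η =ᶠ[nhds z] fun w => toForm p (X w)) (h : HasExtDeriv X D z) :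
    delbar η z = toForm (p + 1) (∑ a, gzb a * zbarPart D a) := by
  obtain ⟨L, hL, hd⟩ := h p 1
  simp only [mul_one] at hL hd
  rw [delbar, hη.fderiv_eq, hd.fderiv,
    alternatizeUncurryFin_eq_toForm _ (Sum.elim (fun _ => 0) (zbarPart D))]
  · simp [Fintype.sum_sum_type]
  · intro v
    have h0 (c : ℂ) : c • toForm p (0 : Ext n) = 0 := by rw [← map_smul, smul_zero, map_zero]
    simp only [antilinPart_apply, hL, Fintype.sum_sum_type, zbarPart, Sum.elim_inl, Sum.elim_inr, h0,
      Finset.sum_const_zero, zero_add, coord_inr, map_smul, map_add]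

/-! ### Smooth families of Hermitian inner products -/

/-- `G` is a smooth family of Hermitian inner products on the open set `s`. -/
structure IsHermOn (G : Cn n → Cn n → Cn n → ℝ) (s : Set (Cn n)) : Prop where
  isOpen : IsOpen s
  inner : ∀ z ∈ s, IsHermInner (G z)
  smooth : ∀ u v, ContDiffOn ℝ ∞ (fun z => G z u v) s

variable {G : Cn n → Cn n → Cn n → ℝ} {s : Set (Cn n)} {z : Cn n}

theorem IsHermOn.contDiffAt_hf (hG : IsHermOn G s) (hz : z ∈ s) (i j : Fin n) :
    ContDiffAt ℝ ∞ (fun w => hf G w i j) z := by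
  have h (u v) : ContDiffAt ℝ ∞ (fun w => (G w u v : ℂ)) z :=
    Complex.ofRealCLM.contDiff.contDiffAt.comp z ((hG.smooth u v).contDiffAt (hG.isOpen.mem_nhds hz))
  unfold hf hMat
  exact contDiffAt_const.mul (((h _ _).add (h _ _)).add (contDiffAt_const.mul ((h _ _).sub (h _ _))))

theorem IsHermOn.hasFDerivAt_hf (hG : IsHermOn G s) (hz : z ∈ s) (i j : Fin n) :
    HasFDerivAt (fun w => hf G w i j) (fderiv ℝ (fun w => hf G w i j) z) z :=
  ((hG.contDiffAt_hf hz i j).differentiableAt (by simp)).hasFDerivAt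

theorem IsHermOn.contDiffAt_fderiv_hf (hG : IsHermOn G s) (hz : z ∈ s) (i j : Fin n) (u : Cn n) :
    ContDiffAt ℝ ∞ (fun w => fderiv ℝ (fun w => hf G w i j) w u) z :=
  ((hG.contDiffAt_hf hz i j).fderiv_right (m := ∞) (by simp)).clm_apply contDiffAt_const

theorem IsHermOn.contDiffAt_pd_hf (hG : IsHermOn G s) (hz : z ∈ s) (a i j : Fin n) :
    ContDiffAt ℝ ∞ (pd a fun w => hf G w i j) z :=
  contDiffAt_const.mul ((hG.contDiffAt_fderiv_hf hz i j _).sub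
    (contDiffAt_const.mul (hG.contDiffAt_fderiv_hf hz i j _)))

theorem IsHermOn.contDiffAt_pdbar_hf (hG : IsHermOn G s) (hz : z ∈ s) (a i j : Fin n) :
    ContDiffAt ℝ ∞ (pdbar a fun w => hf G w i j) z :=
  contDiffAt_const.mul ((hG.contDiffAt_fderiv_hf hz i j _).add
    (contDiffAt_const.mul (hG.contDiffAt_fderiv_hf hz i j _)))

/-- Symmetry of the second real derivative, extended by complex linearity. -/
theorem pdbar_pd_comm {f : Cn n → ℂ} (hf : ContDiffAt ℝ ∞ f z) (a b : Fin n) :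
    pdbar b (pd a f) z = pd a (pdbar b f) z := by
  have hd : DifferentiableAt ℝ (fderiv ℝ f) z :=
    (hf.fderiv_right (m := ∞) (by simp)).differentiableAt (by simp)
  have hs : ∀ u v, fderiv ℝ (fderiv ℝ f) z u v = fderiv ℝ (fderiv ℝ f) z v u :=
    (hf.isSymmSndFDerivAt (by simpa using WithTop.coe_le_coe.2 (le_top (a := (2 : ℕ∞))))).eq
  have h1 (u : Cn n) : HasFDerivAt (fun w => fderiv ℝ f w u)
      ((fderiv ℝ (fderiv ℝ f) z).flip u) z := by
    simpa using hd.hasFDerivAt.clm_apply (hasFDerivAt_const u z)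
  have hp : HasFDerivAt (pd a f) ((1 / 2 : ℂ) • ((fderiv ℝ (fderiv ℝ f) z).flip (e a)
      - Complex.I • (fderiv ℝ (fderiv ℝ f) z).flip (J n (e a)))) z :=
    ((h1 _).sub ((h1 _).const_mul Complex.I)).const_mul _
  have hq : HasFDerivAt (pdbar b f) ((1 / 2 : ℂ) • ((fderiv ℝ (fderiv ℝ f) z).flip (e b)
      + Complex.I • (fderiv ℝ (fderiv ℝ f) z).flip (J n (e b)))) z :=
    ((h1 _).add ((h1 _).const_mul Complex.I)).const_mul _
  rw [pd, pdbar, hp.fderiv, hq.fderiv]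
  simp [hs (e b), hs (J n (e b))]
  ring

/-! ### First and second derivatives of the powers of `ω` -/

theorem Om_add (f g : Fin n → Fin n → ℂ) : Om (fun i j => f i j + g i j) = Om f + Om g := by
  simp only [Om, add_smul, Finset.sum_add_distrib]

theorem Om_smul (c : ℂ) (f : Fin n → Fin n → ℂ) : Om (fun i j => c * f i j) = c • Om f := by
  simp only [Om, mul_smul, Finset.smul_sum]

theorem Om_zPart (f : Fin n → Fin n → Cn n → ℂ) (z : Cn n) (a : Fin n) (x : Ext n) :
    zPart (fun v => Om (fun i j => fderiv ℝ (f i j) z v) * x) a = Om (fun i j => pd a (f i j) z) * x := by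
  simp only [zPart, pd, Om_smul, sub_eq_add_neg, Om_add, ← neg_mul, smul_mul_assoc, add_mul,
    neg_smul]
  rw [neg_mul, smul_mul_assoc]

theorem Om_zbarPart (f : Fin n → Fin n → Cn n → ℂ) (z : Cn n) (a : Fin n) (x : Ext n) :
    zbarPart (fun v => Om (fun i j => fderiv ℝ (f i j) z v) * x) a
      = Om (fun i j => pdbar a (f i j) z) * x := by
  simp only [zbarPart, pdbar, Om_smul, Om_add, smul_mul_assoc, add_mul]

theorem IsHermOn.hasExtDeriv_Om_pow (hG : IsHermOn G s) (hz : z ∈ s) (k : ℕ) :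
    HasExtDeriv (fun w => Om (hf G w) ^ k) (fun v =>
      Om (fun i j => fderiv ℝ (fun w => hf G w i j) z v) *
        ((k : ℂ) • Om (hf G z) ^ (k - 1))) z := by
  refine (HasExtDeriv.Om_pow (F := hf G) (hG.hasFDerivAt_hf hz) k).congr_deriv fun v => ?_
  rw [mul_smul_comm, (Om_commute _ (Om (hf G z) ^ (k - 1))).eq]

theorem IsHermOn.hasExtDeriv_Om (hG : IsHermOn G s) (hz : z ∈ s) :
    HasExtDeriv (fun w => Om (hf G w)) (fun v =>
      Om (fun i j => fderiv ℝ (fun w => hf G w i j) z v) * 1) z := by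
  simpa using hG.hasExtDeriv_Om_pow hz 1

/-- The coefficients of `∂_a ω`. -/
def dOm (G : Cn n → Cn n → Cn n → ℝ) (z : Cn n) (a i j : Fin n) : ℂ := pd a (fun w => hf G w i j) z

/-- The coefficients of `∂_ā ω`. -/
def dbOm (G : Cn n → Cn n → Cn n → ℝ) (z : Cn n) (a i j : Fin n) : ℂ :=
  pdbar a (fun w => hf G w i j) z

/-- The coefficients of `∂_a ∂_b̄ ω`. -/
def ddbOm (G : Cn n → Cn n → Cn n → ℝ) (z : Cn n) (a b i j : Fin n) : ℂ :=
  pd a (fun w => dbOm G w b i j) z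

theorem IsHermOn.del_omega (hG : IsHermOn G s) (hz : z ∈ s) :
    del (fundamentalForm G) z = toForm 3 (∑ a, gz a * Om (dOm G z a)) := by
  rw [del_eq_toForm (.of_forall fun w => fundamentalForm_eq_toForm G w) (hG.hasExtDeriv_Om hz)]
  simp only [Om_zPart (fun i j w => hf G w i j)]
  simp only [mul_one]
  rfl

theorem IsHermOn.delbar_omegaPow (hG : IsHermOn G s) (hz : z ∈ s) {p k : ℕ} (c : ℂ)
    {η : Cn n → Form n p} (hη : ∀ w ∈ s, η w = toForm p (c • Om (hf G w) ^ k)) :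
    delbar η z = toForm (p + 1)
      (∑ b, gzb b * (Om (dbOm G z b) * ((c * k) • Om (hf G z) ^ (k - 1)))) := by
  have h := (hG.hasExtDeriv_Om_pow hz k).const_smul c
  have h' := h.congr_deriv (D' := fun v =>
    Om (fun i j => fderiv ℝ (fun w => hf G w i j) z v) * ((c * k) • Om (hf G z) ^ (k - 1)))
    fun v => by rw [mul_smul, mul_smul_comm c]
  rw [delbar_eq_toForm (Filter.eventually_of_mem (hG.isOpen.mem_nhds hz) hη) h']
  simp only [Om_zbarPart (fun i j w => hf G w i j)]
  rfl

/-- The element of the exterior algebra representing `√-1 ∂∂̄ωᵏ`. -/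
def extDdb (G : Cn n → Cn n → Cn n → ℝ) (k : ℕ) (z : Cn n) : Ext n :=
  (k : ℂ) • ∑ a, ∑ b, ww a b * (Om (ddbOm G z a b) * Om (hf G z) ^ (k - 1)
    + ((k : ℂ) - 1) • (Om (dOm G z a) * Om (dbOm G z b) * Om (hf G z) ^ (k - 2)))

theorem zPart_sum {ι : Type*} (t : Finset ι) (D : ι → Cn n → Ext n) (a : Fin n) :
    zPart (fun v => ∑ i ∈ t, D i v) a = ∑ i ∈ t, zPart (D i) a := by
  simp only [zPart, Finset.smul_sum, ← Finset.sum_sub_distrib]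

theorem zPart_add (D D' : Cn n → Ext n) (a : Fin n) :
    zPart (fun v => D v + D' v) a = zPart D a + zPart D' a := by
  simp only [zPart]; module

/-- The Leibniz rule `∂∂̄ω^k = k ω^{k-1} ∧ ∂∂̄ω + k(k-1) ω^{k-2} ∧ ∂ω ∧ ∂̄ω`, with `dzᵃ` and `dz̄ᵇ`
collected in front. -/
theorem IsHermOn.iDelDelbar_eq (hG : IsHermOn G s) (hz : z ∈ s) {k : ℕ} (hk : 1 ≤ k) :
    iDelDelbarOmegaPow G k z = toForm (2 * (k + 1)) (extDdb G k z) := by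
  -- The formula is needed near `z`, since it is differentiated again. The constant `dz̄ᵇ` stands on
  -- the right so that `mul_const` applies.
  have h1 : delbar (omegaPow G k) =ᶠ[nhds z] fun w => toForm (2 * k + 1)
      (∑ b, Om (hf G w) ^ (k - 1) * Om (dbOm G w b) * ((k : ℂ) • gzb b)) := by
    refine Filter.eventually_of_mem (hG.isOpen.mem_nhds hz) fun w hw => ?_
    rw [hG.delbar_omegaPow hw (k := k) 1 fun w _ => by rw [one_smul, omegaPow_eq_toForm]]
    congr 1
    refine Finset.sum_congr rfl fun b _ => ?_
    rw [one_mul, mul_smul_comm, mul_smul_comm, mul_smul_comm,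
      (((Om_commute _ (gzb b)).mul_left ((Om_commute _ (gzb b)).pow_left (k - 1))).eq).symm,
      (Om_commute _ (Om (hf G w) ^ (k - 1))).eq]
  have h2 (b : Fin n) : HasExtDeriv
      (fun w => Om (hf G w) ^ (k - 1) * Om (dbOm G w b) * ((k : ℂ) • gzb b))
      (fun v => Om (fun i j => fderiv ℝ (fun w => hf G w i j) z v) * ((((k - 1 : ℕ) : ℂ) * k) •
            (Om (dbOm G z b) * Om (hf G z) ^ (k - 2) * gzb b)) +
          Om (fun i j => fderiv ℝ (fun w => dbOm G w b i j) z v) *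
            ((k : ℂ) • (Om (hf G z) ^ (k - 1) * gzb b))) z := by
    refine (((hG.hasExtDeriv_Om_pow hz (k - 1)).mul_Om (F := fun w => dbOm G w b)
      fun i j => ((hG.contDiffAt_pdbar_hf hz b i j).differentiableAt
        (by simp)).hasFDerivAt).mul_const ((k : ℂ) • gzb b)).congr_deriv fun v => ?_
    rw [add_mul, ← (Om_commute (fun i j => fderiv ℝ _ z v) (Om (hf G z) ^ (k - 1))).eq]
    simp only [mul_smul_comm, smul_mul_assoc, smul_smul]
    rw [(Om_commute (dbOm G z b) (Om (hf G z) ^ (k - 2))).eq]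
    simp only [mul_assoc, mul_comm (k : ℂ)]
    rfl
  have h3 := HasExtDeriv.sum Finset.univ h2
  rw [iDelDelbarOmegaPow, del_eq_toForm h1 h3, ← map_smul]
  change toForm (2 * (k + 1)) _ = _
  congr 1
  simp only [zPart_sum, zPart_add, Om_zPart (fun i j w => hf G w i j),
    Om_zPart (fun i j w => dbOm G w _ i j), extDdb, Finset.smul_sum, Finset.mul_sum]
  refine Finset.sum_congr rfl fun a _ => Finset.sum_congr rfl fun b _ => ?_
  have e1 : ((k - 1 : ℕ) : ℂ) = k - 1 := by push_cast [Nat.cast_sub hk]; ring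
  have c1 : Om (dOm G z a) * (Om (dbOm G z b) * Om (hf G z) ^ (k - 2) * gzb b) =
      gzb b * (Om (dOm G z a) * Om (dbOm G z b) * Om (hf G z) ^ (k - 2)) := by
    rw [← mul_assoc, ← mul_assoc]
    exact (((Om_commute _ _).mul_left (Om_commute _ _)).mul_left
      ((Om_commute _ (gzb b)).pow_left (k - 2))).eq
  have c2 : Om (ddbOm G z a b) * (Om (hf G z) ^ (k - 1) * gzb b) =
      gzb b * (Om (ddbOm G z a b) * Om (hf G z) ^ (k - 1)) := by
    rw [← mul_assoc]
    exact ((Om_commute _ _).mul_left ((Om_commute _ (gzb b)).pow_left (k - 1))).eq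
  change Complex.I • (gz a * (Om (dOm G z a) * _ + Om (ddbOm G z a b) * _)) = _
  rw [mul_smul_comm, mul_smul_comm, c1, c2, e1, ww]
  simp only [mul_add, mul_smul_comm, smul_mul_assoc, mul_assoc]
  module

end

section

variable {n : ℕ}

/-! ### Complex conjugation -/

/-- The form of `y` is the complex conjugate of the form of `x`. -/
def IsConj (p : ℕ) (x y : Ext n) : Prop := ∀ v, conj (toForm p x v) = toForm p y v

namespace IsConj

variable {p : ℕ} {x x' y y' : Ext n}

theorem one : IsConj 0 (1 : Ext n) 1 := fun v => by
  rw [toForm_apply, multiCt_zero, eps_one, map_one]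

theorem sum {ι : Type*} (s : Finset ι) {x y : ι → Ext n} (h : ∀ i, IsConj p (x i) (y i)) :
    IsConj p (∑ i ∈ s, x i) (∑ i ∈ s, y i) := fun v => by
  simp only [map_sum, ContinuousAlternatingMap.sum_apply]
  exact Finset.sum_congr rfl fun i _ => h i v

theorem smul (h : IsConj p x y) {c d : ℂ} (hc : conj c = d) : IsConj p (c • x) (d • y) := fun v => by
  simp only [map_smul, ContinuousAlternatingMap.smul_apply, smul_eq_mul, map_mul, h v, hc]

theorem gen_mul (h : IsConj p x y) (A : Fin n ⊕ Fin n) :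
    IsConj (p + 1) (gen A * x) (gen A.swap * y) := fun v => by
  simp only [gen, toForm_ι_mul, evR_single, map_sum, map_mul, map_pow, map_neg, map_one]
  refine Finset.sum_congr rfl fun j _ => ?_
  rw [h]
  congr 2
  rcases A with i | i <;> simp

theorem sub (h : IsConj p x y) (h' : IsConj p x' y') : IsConj p (x - x') (y - y') := fun v => by
  simp only [map_sub, ContinuousAlternatingMap.sub_apply, h v, h' v]

end IsConj

theorem isConj_gzb (i : Fin n) : IsConj 1 (gzb i) (gz i) := by
  simpa using IsConj.one.gen_mul (Sum.inr i)

theorem isConj_ww (i j : Fin n) : IsConj 2 (ww i j) (ww j i) := by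
  have := ((isConj_gzb j).gen_mul (Sum.inl i)).smul Complex.conj_I
  rwa [neg_smul, ← smul_neg, Sum.swap_inl, ← gen_mul_gen] at this

theorem isConj_gz_mul_Om (a : Fin n) {f g : Fin n → Fin n → ℂ} (hfg : ∀ i j, conj (f i j) = g j i) :
    IsConj 3 (gz a * Om f) (gzb a * Om g) := by
  have : Om g = ∑ i, ∑ j, g j i • ww j i := Finset.sum_comm
  rw [this]
  exact (IsConj.sum _ fun i => IsConj.sum _ fun j => (isConj_ww i j).smul (hfg i j)).gen_mul (Sum.inl a)

variable {G : Cn n → Cn n → Cn n → ℝ} {s : Set (Cn n)} {z : Cn n}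

theorem hInv_conj (hB : IsHermInner (G z)) (i j : Fin n) : conj (hInv G z i j) = hInv G z j i := by
  have h1 : (hMat G z).conjTranspose = hMat G z := by
    ext i j
    exact hf_conj hB j i
  have h2 := congrFun (congrFun (Matrix.conjTranspose_nonsing_inv (hMat G z)) i) j
  rw [h1] at h2
  exact h2

theorem conj_pd {f : Cn n → ℂ} (hf : DifferentiableAt ℝ f z) (a : Fin n) :
    conj (pd a f z) = pdbar a (fun w => conj (f w)) z := by
  have h1 : HasFDerivAt (fun w => conj (f w)) ((Complex.conjCLE : ℂ →L[ℝ] ℂ).comp (fderiv ℝ f z)) z :=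
    (Complex.conjCLE : ℂ →L[ℝ] ℂ).hasFDerivAt.comp z hf.hasFDerivAt
  have h2 : conj (2 : ℂ) = 2 := map_ofNat _ 2
  rw [pd, pdbar, h1.fderiv]
  simp [h2]

theorem IsHermOn.differentiableAt_hf (hG : IsHermOn G s) (hz : z ∈ s) (i j : Fin n) :
    DifferentiableAt ℝ (fun w => hf G w i j) z :=
  (hG.contDiffAt_hf hz i j).differentiableAt (by simp)

theorem IsHermOn.conj_hf_eventuallyEq (hG : IsHermOn G s) (hz : z ∈ s) (i j : Fin n) :
    (fun w => conj (hf G w i j)) =ᶠ[nhds z] fun w => hf G w j i :=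
  Filter.eventually_of_mem (hG.isOpen.mem_nhds hz) fun w hw => hf_conj (hG.inner w hw) i j

theorem IsHermOn.conj_dOm (hG : IsHermOn G s) (hz : z ∈ s) (a i j : Fin n) :
    conj (dOm G z a i j) = dbOm G z a j i := by
  rw [dOm, conj_pd (hG.differentiableAt_hf hz i j), dbOm, pdbar, pdbar,
    (hG.conj_hf_eventuallyEq hz i j).fderiv_eq]

theorem IsHermOn.conj_dbOm (hG : IsHermOn G s) (hz : z ∈ s) (a i j : Fin n) :
    conj (dbOm G z a i j) = dOm G z a j i := by
  rw [← hG.conj_dOm hz, Complex.conj_conj]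

/-! ### Curvature -/

/-- This and the next two lemmas only reorder six-fold sums, so that all quadratic expressions in
the first derivatives of `h` can be compared termwise. -/
theorem sum_swap_triples {ι : Type*} [Fintype ι] (φ : ι → ι → ι → ι → ι → ι → ℂ) :
    ∑ x, ∑ y, ∑ w, ∑ a, ∑ b, ∑ c, φ x y w a b c = ∑ a, ∑ b, ∑ c, ∑ x, ∑ y, ∑ w, φ x y w a b c := by
  simpa only [Fintype.sum_prod_type] using
    Finset.sum_comm (s := Finset.univ) (t := Finset.univ)
      (f := fun (p q : ι × ι × ι) => φ p.1 p.2.1 p.2.2 q.1 q.2.1 q.2.2)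

theorem sum_reorder_curv {ι : Type*} [Fintype ι] (φ : ι → ι → ι → ι → ι → ι → ℂ) :
    ∑ a, ∑ b, ∑ c, ∑ f, ∑ e, ∑ d, φ a c d b e f = ∑ a, ∑ c, ∑ d, ∑ b, ∑ e, ∑ f, φ a c d b e f := by
  let E : ι × ι × ι × ι × ι × ι ≃ ι × ι × ι × ι × ι × ι :=
    { toFun := fun ⟨a, b, c, f, e, d⟩ => ⟨a, c, d, b, e, f⟩
      invFun := fun ⟨a, c, d, b, e, f⟩ => ⟨a, b, c, f, e, d⟩
      left_inv := fun _ => rfl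
      right_inv := fun _ => rfl }
  have := E.sum_comp fun q => φ q.1 q.2.1 q.2.2.1 q.2.2.2.1 q.2.2.2.2.1 q.2.2.2.2.2
  simp only [Fintype.sum_prod_type] at this
  exact this

theorem sum_reorder_top {ι : Type*} [Fintype ι] (φ : ι → ι → ι → ι → ι → ι → ℂ) :
    ∑ a, ∑ b, ∑ c, ∑ d, ∑ e, ∑ f, φ a c d b e f = ∑ a, ∑ c, ∑ d, ∑ b, ∑ e, ∑ f, φ a c d b e f := by
  let E : ι × ι × ι × ι × ι × ι ≃ ι × ι × ι × ι × ι × ι :=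
    { toFun := fun ⟨a, b, c, d, e, f⟩ => ⟨a, c, d, b, e, f⟩
      invFun := fun ⟨a, c, d, b, e, f⟩ => ⟨a, b, c, d, e, f⟩
      left_inv := fun _ => rfl
      right_inv := fun _ => rfl }
  have := E.sum_comp fun q => φ q.1 q.2.1 q.2.2.1 q.2.2.2.1 q.2.2.2.2.1 q.2.2.2.2.2
  simp only [Fintype.sum_prod_type] at this
  exact this

theorem pdbar_mul {f g : Cn n → ℂ} (hf : DifferentiableAt ℝ f z) (hg : DifferentiableAt ℝ g z)
    (a : Fin n) : pdbar a (fun w => f w * g w) z = pdbar a f z * g z + f z * pdbar a g z := by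
  have := hf.hasFDerivAt.mul hg.hasFDerivAt
  simp only [pdbar, show fderiv ℝ (fun w => f w * g w) z = _ from this.fderiv]
  simp
  ring

theorem pdbar_sum {ι : Type*} (t : Finset ι) {f : ι → Cn n → ℂ}
    (hf : ∀ i, DifferentiableAt ℝ (f i) z) (a : Fin n) :
    pdbar a (fun w => ∑ i ∈ t, f i w) z = ∑ i ∈ t, pdbar a (f i) z := by
  simp only [pdbar, fderiv_fun_sum fun i _ => hf i, _root_.sum_apply, Finset.mul_sum,
    ← Finset.sum_add_distrib]

theorem differentiableAt_det {m : Type*} [Fintype m] [DecidableEq m] {A : Cn n → Matrix m m ℂ}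
    (hA : ∀ i j, DifferentiableAt ℝ (fun w => A w i j) z) :
    DifferentiableAt ℝ (fun w => (A w).det) z := by
  simp only [Matrix.det_apply']
  exact DifferentiableAt.fun_sum fun σ _ =>
    (HasFDerivAt.finsetProd fun i _ => (hA (σ i) i).hasFDerivAt).differentiableAt.const_mul _

/-- Cramer's rule: the entries are cofactors divided by a nonvanishing determinant. -/
theorem IsHermOn.differentiableAt_hInv (hG : IsHermOn G s) (hz : z ∈ s) (i j : Fin n) :
    DifferentiableAt ℝ (fun w => hInv G w i j) z := by
  have h1 : DifferentiableAt ℝ (fun w => (hMat G w).det) z :=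
    differentiableAt_det fun i j => hG.differentiableAt_hf hz i j
  have h2 : DifferentiableAt ℝ (fun w => (hMat G w).adjugate j i) z := by
    simp only [Matrix.adjugate_apply]
    refine differentiableAt_det fun a b => ?_
    simp only [Matrix.updateRow_apply]
    split_ifs
    · exact differentiableAt_const _
    · exact hG.differentiableAt_hf hz a b
  simp only [hInv, Matrix.inv_def, Ring.inverse_eq_inv', Matrix.smul_apply, smul_eq_mul]
  exact (h1.inv (hMat_isUnit_det (hG.inner z hz)).ne_zero).mul h2

theorem IsHermOn.differentiableAt_christoffel (hG : IsHermOn G s) (hz : z ∈ s) (i j k : Fin n) :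
    DifferentiableAt ℝ (christoffel G i j k) z :=
  DifferentiableAt.fun_sum fun l _ => (hG.differentiableAt_hInv hz k l).mul
    ((hG.contDiffAt_pd_hf hz i j l).differentiableAt (by simp))

theorem hf_mul_christoffel (hB : IsHermInner (G z)) (i j l : Fin n) :
    ∑ p, hf G z p l * christoffel G i j p z = dOm G z i j l := by
  have h1 (p : Fin n) : christoffel G i j p z = ∑ q, hInv G z p q * dOm G z i j q := rfl
  simp only [h1, Finset.mul_sum, ← mul_assoc]
  rw [Finset.sum_comm]
  simp only [← Finset.sum_mul, mul_comm (hf G z _ _), (isInv_hf hB).left]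
  simp

/-- Differentiate `h_{pl̄} Γ_{ik}^p = ∂ᵢ h_{kl̄}` in `z̄ʲ` and solve for the term containing `∂_{j̄}
Γ`. This avoids a formula for the derivative of `h^{-1}`. -/
theorem IsHermOn.chernCurv_eq (hG : IsHermOn G s) (hz : z ∈ s) (i j k l : Fin n) :
    chernCurv G i j k l z = -ddbOm G z i j k l +
      ∑ p, ∑ q, dbOm G z j p l * (hInv G z p q * dOm G z i k q) := by
  have h1 : (fun w => ∑ p, hf G w p l * christoffel G i k p w) =ᶠ[nhds z]
      pd i fun w => hf G w k l :=
    Filter.eventually_of_mem (hG.isOpen.mem_nhds hz) fun w hw =>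
      hf_mul_christoffel (hG.inner w hw) i k l
  have h2 : pdbar j (fun w => ∑ p, hf G w p l * christoffel G i k p w) z = ddbOm G z i j k l := by
    rw [ddbOm, pdbar, h1.fderiv_eq, ← pdbar]
    exact pdbar_pd_comm (hG.contDiffAt_hf hz k l) i j
  rw [pdbar_sum (f := fun p w => hf G w p l * christoffel G i k p w) _ fun p => (hG.differentiableAt_hf hz p l).mul
    (hG.differentiableAt_christoffel hz i k p)] at h2
  simp only [pdbar_mul (hG.differentiableAt_hf hz _ l) (hG.differentiableAt_christoffel hz i k _),
    Finset.sum_add_distrib] at h2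
  rw [← h2, chernCurv]
  simp only [christoffel, Finset.mul_sum]
  change -∑ p, hf G z p l * _ = -(∑ p, ∑ q, dbOm G z j p l * (hInv G z p q * dOm G z i k q) + _) + _
  ring

/-- The coefficient of `√-1 ∂∂̄ω ∧ ωⁿ⁻²`. -/
def ddbTrace (G : Cn n → Cn n → Cn n → ℝ) (z : Cn n) : ℂ :=
  ∑ a, ∑ b, ∑ i, ∑ j, ddbOm G z a b i j *
    (hInv G z a b * hInv G z i j - hInv G z a j * hInv G z i b)

/-- Since `h` is Hermitian, the conjugate of `∂ω` is `∂̄ω`, so the norm is the contraction of `∂̄ω`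
by the metric dual of `∂ω`, evaluated on monomials. -/
theorem IsHermOn.normSqDelOmega_eq (hG : IsHermOn G s) (hz : z ∈ s) :
    normSqDelOmega G z = ∑ a, ∑ c, ∑ d, ∑ b, ∑ e, ∑ f, dOm G z a c d * dbOm G z b e f *
      ((hInv G z a b * hInv G z c f - hInv G z a f * hInv G z c b) * hInv G z e d) := by
  have hB := hG.inner z hz
  have I2 : Complex.I * Complex.I = -1 := Complex.I_mul_I
  have hm : (∑ a, gz a * Om (dOm G z a)) ∈ ⋀[ℂ]^3 (Cov n) :=
    Submodule.sum_mem _ fun a _ => mul_mem_ext (p := 1) (q := 2) (gen_mem_ext _) (Om_mem _)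
  have hc : IsConj 3 (∑ a, gz a * Om (dOm G z a)) (∑ b, gzb b * Om (dbOm G z b)) :=
    IsConj.sum _ fun a => isConj_gz_mul_Om a fun i j => hG.conj_dOm hz a i j
  have key (a c d b e f : Fin n) : eps (cact (sharp G z) (gz a * ww c d) (gzb b * ww e f)) =
      (hInv G z a b * hInv G z c f - hInv G z a f * hInv G z c b) * hInv G z e d := by
    rw [cact_mul_apply, cact_sharp_gz hB, cact_sharp_ww hB, ct_gen_mul, colVec_inr, ct_ww, colVec_inl,
      colVec_inr, map_sub, map_smul]
    simp only [ct_ww, mul_zero, zero_smul, zero_sub, mul_neg, mul_smul_comm, map_neg, map_smul, ct_gen_mul,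
      ct_gen, colVec_inl, colVec_inr, rowVec_inl, map_sub, smul_eq_mul, eps_one, mul_one, sub_zero]
    linear_combination (hInv G z a f * hInv G z c b - hInv G z a b * hInv G z c f) *
      hInv G z e d * I2
  rw [normSqDelOmega, hG.del_omega hz, formInner_toForm hm _ hc]
  simp only [Om, Finset.mul_sum, mul_smul_comm, map_sum, map_smul, LinearMap.sum_apply,
    LinearMap.smul_apply, smul_eq_mul, key]
  refine (sum_swap_triples _).trans ?_
  simp only [mul_left_comm (dbOm G z _ _ _), mul_assoc]

/-- The difference `s - ŝ` antisymmetrises the traces of the curvature. Its second-order part is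
minus `ddbTrace`, and its quadratic part is exactly `|∂ω|²`. -/
theorem IsHermOn.chernScalar_sub (hG : IsHermOn G s) (hz : z ∈ s) :
    chernScalar G z - chernScalarHat G z = normSqDelOmega G z - ddbTrace G z := by
  rw [hG.normSqDelOmega_eq hz, ddbTrace, chernScalar, chernScalarHat]
  simp only [← Finset.sum_sub_distrib, hG.chernCurv_eq hz]
  have h1 (i j k l : Fin n) : hInv G z i j * hInv G z k l * (-ddbOm G z i j k l +
      ∑ p, ∑ q, dbOm G z j p l * (hInv G z p q * dOm G z i k q)) -
      hInv G z i l * hInv G z k j * (-ddbOm G z i j k l +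
      ∑ p, ∑ q, dbOm G z j p l * (hInv G z p q * dOm G z i k q)) =
      (∑ p, ∑ q, dOm G z i k q * dbOm G z j p l * ((hInv G z i j * hInv G z k l -
        hInv G z i l * hInv G z k j) * hInv G z p q)) -
      ddbOm G z i j k l * (hInv G z i j * hInv G z k l - hInv G z i l * hInv G z k j) := by
    rw [← sub_mul, mul_add, Finset.mul_sum, add_comm, sub_eq_add_neg _ (ddbOm G z i j k l * _)]
    congr 1
    · refine Finset.sum_congr rfl fun p _ => ?_
      rw [Finset.mul_sum]
      exact Finset.sum_congr rfl fun q _ => by ring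
    · ring
  simp only [h1, Finset.sum_sub_distrib]
  rw [sub_left_inj]
  exact sum_reorder_curv fun a c d b e f => dOm G z a c d * dbOm G z b e f *
    ((hInv G z a b * hInv G z c f - hInv G z a f * hInv G z c b) * hInv G z e d)

/-! ### The codifferential of the fundamental form -/

/-- Here `*ω = ω^{n-1}/(n-1)!`, so `∂̄*ω = ω^{n-2} ∧ ∂̄ω/(n-2)!`. The outer star applies `Λ^{n-2}`
to `ωⁿ/n!`, leaving a multiple of `ω²`, which is then contracted by the dual of `∂̄ω`. -/
theorem IsHermOn.delStar_omega (hG : IsHermOn G s) (hz : z ∈ s) (hn : 2 ≤ n) :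
    delStar G (p := 1) (fundamentalForm G) z = toForm 1 (∑ b, ∑ e, ∑ f, dbOm G z b e f •
      (-Complex.I) • (hInv G z e f • gzb b - hInv G z e b • gzb f)) := by
  have hB := hG.inner z hz
  have hfac : (n.factorial : ℂ) ≠ 0 := Nat.cast_ne_zero.2 (Nat.factorial_ne_zero _)
  have h1 : ∀ w ∈ s, hodge G w (p := 1 + 1) (q := 2 * n - (1 + 1)) (by omega) (fundamentalForm G w) =
      toForm (2 * n - (1 + 1)) (((n.factorial : ℂ)⁻¹ * n) • Om (hf G w) ^ (n - 1)) := by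
    intro w hw
    have hBw := hG.inner w hw
    rw [fundamentalForm_eq_toForm, hodge_toForm (p := 2) _ (Om_mem _), cact_sharp_Om hBw, map_smul]
    have := extLam_iterate_Om_pow (isInv_hf hBw) 1 (by omega)
    simp only [Function.iterate_one, Nat.descFactorial_one, Nat.factorial_one, Nat.cast_one,
      mul_one] at this
    rw [this, smul_smul]
  have h2 := hG.delbar_omegaPow hz ((n.factorial : ℂ)⁻¹ * n) h1
  have h3 (b e f : Fin n) : cact (sharp G z) (gzb b * ww e f) (Om (hf G z) ^ 2) =
      (2 * Complex.I) • (hInv G z e f • gzb b - hInv G z e b • gzb f) := by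
    have I2 : Complex.I * Complex.I = -1 := Complex.I_mul_I
    have i1 : ct (rowVec (hInv G z) b) (Om (hf G z) ^ 2) =
        (2 * Complex.I) • (Om (hf G z) * gzb b) := by
      have := ct_Om_pow_mul (hf G z) (rowVec (hInv G z) b) 2 1
      rw [mul_one, ct_one, mul_zero, add_zero, ct_rowVec_Om (isInv_hf hB)] at this
      rw [this, mul_one, smul_mul_assoc, smul_smul, (Om_commute _ (gzb b)).eq, pow_one]
      push_cast; rfl
    rw [cact_mul_apply, cact_sharp_gzb hB, cact_sharp_ww hB, i1]
    simp only [map_smul, ct_Om_mul, ct_colVec_Om (isInv_hf hB), ct_gen, colVec_inr, map_add, neg_mul,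
      smul_mul_assoc, mul_smul_comm, mul_one, ct_rowVec_Om (isInv_hf hB), map_neg, ct_gen_mul,
      rowVec_inl, rowVec_inr, zero_smul, mul_zero, sub_zero]
    match_scalars
    · linear_combination (-(2 * Complex.I * hInv G z e f)) * I2
    · linear_combination (2 * Complex.I * hInv G z e b) * I2
  have hx : (∑ b, gzb b * (Om (dbOm G z b) *
      (((n.factorial : ℂ)⁻¹ * n * (n - 1 : ℕ)) • Om (hf G z) ^ (n - 1 - 1)))) =
      ((n.factorial : ℂ)⁻¹ * n * (n - 1 : ℕ)) •
        (Om (hf G z) ^ (n - 2) * ∑ b, gzb b * Om (dbOm G z b)) := by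
    rw [Finset.mul_sum, Finset.smul_sum]
    refine Finset.sum_congr rfl fun b _ => ?_
    rw [mul_smul_comm, mul_smul_comm, ← mul_assoc, ((Om_commute (hf G z) _).pow_left (n - 2)).eq]
    rfl
  have hmem : Om (hf G z) ^ (n - 2) * ∑ b, gzb b * Om (dbOm G z b) ∈
      ⋀[ℂ]^(2 * n - (1 + 1) + 1) (Cov n) := by
    have := mul_mem_ext (Om_pow_mem (hf G z) (n - 2)) (Submodule.sum_mem _ fun b (_ : b ∈ Finset.univ) =>
      mul_mem_ext (p := 1) (q := 2) (gen_mem_ext (Sum.inr b)) (Om_mem (dbOm G z b)))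
    rwa [show 2 * (n - 2) + (1 + 2) = 2 * n - (1 + 1) + 1 by omega] at this
  -- All factorials cancel to `1/2`, which absorbs the 2 from contracting `ω²` in `h3`.
  have hcoef : ((n.factorial : ℂ)⁻¹ * n * (n - 1 : ℕ)) * ((n.factorial : ℂ)⁻¹ *
      (n.descFactorial (n - 2) * (n - 2).factorial)) = 1 / 2 := by
    obtain ⟨m, rfl⟩ : ∃ m, n = m + 2 := ⟨n - 2, by omega⟩
    have e1 := Nat.factorial_mul_descFactorial (show m ≤ m + 2 by omega)
    have e2 : (m + 2).factorial = (m + 2) * ((m + 1) * m.factorial) := by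
      rw [Nat.factorial_succ, Nat.factorial_succ]
    rw [show m + 2 - m = 2 by omega, Nat.factorial_two] at e1
    have e1' : (2 : ℂ) * (m + 2).descFactorial m = (m + 2).factorial := by exact_mod_cast e1
    have e2' : ((m + 2).factorial : ℂ) = (m + 2) * ((m + 1) * m.factorial) := by exact_mod_cast e2
    simp only [Nat.add_sub_cancel, show m + 2 - 1 = m + 1 by omega]
    push_cast
    field_simp
    linear_combination ((m : ℂ) + 2) * (m + 1) * m.factorial * e1' - (m + 2).factorial * e2'
  rw [delStar, dif_pos (by omega), h2, hx, hodge_toForm _ (Submodule.smul_mem _ _ hmem),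
    map_smul (cact (sharp G z) _), map_smul (cact (sharp G z)), LinearMap.smul_apply,
    cact_sharp_Om_pow_mul hB, extLam_iterate_Om_pow (isInv_hf hB) _ (by omega),
    show n - (n - 2) = 2 by omega, map_smul (cact (sharp G z) _), smul_comm, smul_smul, smul_smul,
    mul_assoc, hcoef, ← map_neg]
  congr 1
  simp only [Om, Finset.mul_sum, mul_smul_comm, map_sum, map_smul, LinearMap.sum_apply,
    LinearMap.smul_apply, Finset.smul_sum, ← Finset.sum_neg_distrib]
  refine Finset.sum_congr rfl fun b _ => Finset.sum_congr rfl fun e _ =>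
    Finset.sum_congr rfl fun f _ => ?_
  have := h3 b e f
  simp only [Om] at this
  rw [this]
  module

theorem IsHermOn.normSqDelStarOmega_eq (hG : IsHermOn G s) (hz : z ∈ s) (hn : 2 ≤ n) :
    normSqDelStarOmega G z = ∑ a, ∑ c, ∑ d, ∑ b, ∑ e, ∑ f, dOm G z a c d * dbOm G z b e f *
      (hInv G z e f * hInv G z c d * hInv G z a b - hInv G z e f * hInv G z a d * hInv G z c b
        - hInv G z e b * hInv G z c d * hInv G z a f
        + hInv G z e b * hInv G z a d * hInv G z c f) := by
  have hB := hG.inner z hz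
  have I2 : Complex.I * Complex.I = -1 := Complex.I_mul_I
  have hm : (∑ b, ∑ e, ∑ f, dbOm G z b e f •
      (-Complex.I) • (hInv G z e f • gzb b - hInv G z e b • gzb f)) ∈ ⋀[ℂ]^1 (Cov n) :=
    Submodule.sum_mem _ fun b _ => Submodule.sum_mem _ fun e _ => Submodule.sum_mem _ fun f _ =>
      Submodule.smul_mem _ _ (Submodule.smul_mem _ _ (Submodule.sub_mem _
        (Submodule.smul_mem _ _ (gen_mem_ext _)) (Submodule.smul_mem _ _ (gen_mem_ext _))))
  have hc : IsConj 1 (∑ b, ∑ e, ∑ f, dbOm G z b e f •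
      (-Complex.I) • (hInv G z e f • gzb b - hInv G z e b • gzb f))
      (∑ a, ∑ d, ∑ c, dOm G z a c d • Complex.I • (hInv G z c d • gz a - hInv G z a d • gz c)) :=
    IsConj.sum _ fun b => IsConj.sum _ fun e => IsConj.sum _ fun f =>
      IsConj.smul (IsConj.smul (IsConj.sub ((isConj_gzb b).smul (hInv_conj hB e f))
        ((isConj_gzb f).smul (hInv_conj hB e b))) (by simp)) (hG.conj_dbOm hz b e f)
  have hs : (∑ a, ∑ d, ∑ c, dOm G z a c d • Complex.I •
        (hInv G z c d • gz a - hInv G z a d • gz c) : Ext n) =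
      ∑ a, ∑ c, ∑ d, dOm G z a c d • Complex.I • (hInv G z c d • gz a - hInv G z a d • gz c) :=
    Finset.sum_congr rfl fun a _ => Finset.sum_comm
  rw [hs] at hc
  rw [normSqDelStarOmega, hG.delStar_omega hz hn, formInner_toForm hm _ hc]
  simp only [map_sum, map_smul, map_sub, LinearMap.sum_apply, LinearMap.smul_apply,
    LinearMap.sub_apply, smul_eq_mul, cact_sharp_gzb hB, ct_gen, rowVec_inl, eps_one, mul_one]
  simp only [Finset.mul_sum, ← Finset.sum_sub_distrib]
  refine Finset.sum_congr rfl fun a _ => Finset.sum_congr rfl fun c _ =>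
    Finset.sum_congr rfl fun d _ => Finset.sum_congr rfl fun b _ => Finset.sum_congr rfl fun e _ =>
    Finset.sum_congr rfl fun f _ => ?_
  linear_combination (-(dOm G z a c d * dbOm G z b e f *
      (hInv G z e f * hInv G z c d * hInv G z a b - hInv G z e f * hInv G z a d * hInv G z c b
        - hInv G z e b * hInv G z c d * hInv G z a f
        + hInv G z e b * hInv G z a d * hInv G z c f))) * I2

end

section

variable {n : ℕ} {G : Cn n → Cn n → Cn n → ℝ} {s : Set (Cn n)} {z : Cn n}

/-! ### The top degree form `√-1 ∂∂̄ωᵏ ∧ ωⁿ⁻ᵏ⁻¹` -/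

theorem sum_ww_mul_Om (hB : IsHermInner (G z)) (hn : 2 ≤ n) :
    ((n : ℂ) * (n - 1)) • ∑ a, ∑ b, Om (hf G z) ^ (n - 2) * (ww a b * Om (ddbOm G z a b)) =
      ddbTrace G z • Om (hf G z) ^ n := by
  have key (a b c d : Fin n) : (ddbOm G z a b c d * (hInv G z a b * hInv G z c d -
      hInv G z a d * hInv G z c b)) • Om (hf G z) ^ n = ddbOm G z a b c d •
        ((n : ℂ) * (n - 1)) • (Om (hf G z) ^ (n - 2) * (ww a b * ww c d)) := by
    rw [mul_smul, top_two (isInv_hf hB) hn a b c d]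
  simp only [ddbTrace, Finset.sum_smul, key]
  simp only [Finset.smul_sum]
  refine Finset.sum_congr rfl fun a _ => Finset.sum_congr rfl fun b _ => ?_
  have e1 : Om (ddbOm G z a b) = ∑ c, ∑ d, ddbOm G z a b c d • ww c d := rfl
  rw [e1]
  simp only [Finset.mul_sum, Finset.smul_sum, mul_smul_comm, smul_comm ((n : ℂ) * (n - 1))]

/-- Of the six terms of the minor in `top_three`, the two containing `h^{ed̄}` give `-|∂ω|²`; the
other four give `|∂*ω|²`. -/
theorem IsHermOn.sum_ww_mul_Om_mul_Om (hG : IsHermOn G s) (hz : z ∈ s) (hn : 3 ≤ n) :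
    ((n : ℂ) * (n - 1) * (n - 2)) • ∑ a, ∑ b, Om (hf G z) ^ (n - 3) *
        (ww a b * (Om (dOm G z a) * Om (dbOm G z b))) =
      (normSqDelStarOmega G z - normSqDelOmega G z) • Om (hf G z) ^ n := by
  have key (a b c d e f : Fin n) := top_three (isInv_hf (hG.inner z hz)) hn a b c d e f
  have h1 : normSqDelStarOmega G z - normSqDelOmega G z = ∑ a, ∑ b, ∑ c, ∑ d, ∑ e, ∑ f,
      dOm G z a c d * (dbOm G z b e f * (hInv G z e f * (hInv G z a b * hInv G z c d -
        hInv G z a d * hInv G z c b) - hInv G z a f * (hInv G z e b * hInv G z c d -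
        hInv G z e d * hInv G z c b) - hInv G z c f * (hInv G z a b * hInv G z e d -
        hInv G z a d * hInv G z e b))) := by
    rw [hG.normSqDelOmega_eq hz, hG.normSqDelStarOmega_eq hz (by omega)]
    simp only [← Finset.sum_sub_distrib]
    rw [sum_reorder_top fun a c d b e f => dOm G z a c d * (dbOm G z b e f *
      (hInv G z e f * (hInv G z a b * hInv G z c d -
        hInv G z a d * hInv G z c b) - hInv G z a f * (hInv G z e b * hInv G z c d -
        hInv G z e d * hInv G z c b) - hInv G z c f * (hInv G z a b * hInv G z e d -
        hInv G z a d * hInv G z e b)))]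
    refine Finset.sum_congr rfl fun a _ => Finset.sum_congr rfl fun c _ =>
      Finset.sum_congr rfl fun d _ => Finset.sum_congr rfl fun b _ => Finset.sum_congr rfl fun e _ =>
      Finset.sum_congr rfl fun f _ => ?_
    ring
  rw [h1]
  simp only [Finset.sum_smul, mul_smul (dOm G z _ _ _), mul_smul (dbOm G z _ _ _), ← key]
  simp only [Finset.smul_sum]
  refine Finset.sum_congr rfl fun a _ => Finset.sum_congr rfl fun b _ => ?_
  have e1 : Om (dOm G z a) * Om (dbOm G z b) = ∑ c, ∑ d, ∑ e, ∑ f,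
      dOm G z a c d • dbOm G z b e f • (ww c d * ww e f) := by
    simp only [Om, Finset.sum_mul]
    refine Finset.sum_congr rfl fun c _ => Finset.sum_congr rfl fun d _ => ?_
    simp only [Finset.mul_sum, smul_mul_assoc, mul_smul_comm, smul_comm (dOm G z a c d)]
  rw [e1]
  simp only [Finset.mul_sum, Finset.smul_sum, mul_smul_comm,
    smul_comm ((n : ℂ) * (n - 1) * (n - 2))]

theorem extDdb_mem {k : ℕ} (hk : 1 ≤ k) : extDdb G k z ∈ ⋀[ℂ]^(2 * (k + 1)) (Cov n) := by
  rw [extDdb]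
  apply Submodule.smul_mem
  refine Submodule.sum_mem _ fun a _ => ?_
  refine Submodule.sum_mem _ fun b _ => ?_
  rw [mul_add (ww a b)]
  apply Submodule.add_mem
  · have := mul_mem_ext (ww_mem a b) (mul_mem_ext (Om_mem (ddbOm G z a b)) (Om_pow_mem (hf G z) (k - 1)))
    rwa [show 2 + (2 + 2 * (k - 1)) = 2 * (k + 1) by omega] at this
  -- For `k = 1` the exponent `k - 2` is truncated and the degree would be wrong, but the
  -- coefficient `k - 1` vanishes.
  · rcases hk.eq_or_lt with rfl | hk
    · simp
    · rw [mul_smul_comm]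
      apply Submodule.smul_mem
      have := mul_mem_ext (ww_mem a b) (mul_mem_ext (mul_mem_ext (Om_mem (dOm G z a))
        (Om_mem (dbOm G z b))) (Om_pow_mem (hf G z) (k - 2)))
      rwa [show 2 + (2 + 2 + 2 * (k - 2)) = 2 * (k + 1) by omega] at this

theorem IsHermOn.Om_pow_mul_extDdb (hG : IsHermOn G s) (hz : z ∈ s) (hn : 3 ≤ n) {k : ℕ} (hk : 1 ≤ k)
    (hkn : k ≤ n - 1) :
    ((n : ℂ) * (n - 1) * (n - 2)) • (Om (hf G z) ^ (n - k - 1) * extDdb G k z) =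
      ((k : ℂ) * ((n - 2) * ddbTrace G z + (k - 1) *
        (normSqDelStarOmega G z - normSqDelOmega G z))) • Om (hf G z) ^ n := by
  have h1 : Om (hf G z) ^ (n - k - 1) * extDdb G k z = (k : ℂ) •
      (∑ a, ∑ b, Om (hf G z) ^ (n - 2) * (ww a b * Om (ddbOm G z a b)) + ((k : ℂ) - 1) •
        ∑ a, ∑ b, Om (hf G z) ^ (n - 3) * (ww a b * (Om (dOm G z a) * Om (dbOm G z b)))) := by
    rw [extDdb, mul_smul_comm]
    congr 1
    simp only [Finset.mul_sum, Finset.smul_sum, ← Finset.sum_add_distrib]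
    refine Finset.sum_congr rfl fun a _ => Finset.sum_congr rfl fun b _ => ?_
    rw [mul_add, mul_add, mul_smul_comm, mul_smul_comm, ← mul_assoc (ww a b), ← mul_assoc (ww a b),
      ← ((Om_commute (hf G z) _).pow_left (k - 1)).eq, ← ((Om_commute (hf G z) _).pow_left (k - 2)).eq,
      ← mul_assoc, ← mul_assoc (Om (hf G z) ^ (n - k - 1)) (Om (hf G z) ^ (k - 2)), ← pow_add,
      ← pow_add, show n - k - 1 + (k - 1) = n - 2 by omega]
    congr 1
    rcases hk.eq_or_lt with rfl | hk
    · simp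
    · rw [show n - k - 1 + (k - 2) = n - 3 by omega]
  have e1 := sum_ww_mul_Om (hG.inner z hz) (show 2 ≤ n by omega)
  have e2 := hG.sum_ww_mul_Om_mul_Om hz hn
  set A := ∑ a, ∑ b, Om (hf G z) ^ (n - 2) * (ww a b * Om (ddbOm G z a b))
  set B := ∑ a, ∑ b, Om (hf G z) ^ (n - 3) * (ww a b * (Om (dOm G z a) * Om (dbOm G z b)))
  calc _ = ((k : ℂ) * (n - 2)) • (((n : ℂ) * (n - 1)) • A) +
        ((k : ℂ) * (k - 1)) • (((n : ℂ) * (n - 1) * (n - 2)) • B) := by rw [h1]; module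
    _ = _ := by rw [e1, e2]; module

/-- Nondegeneracy of `ωⁿ`: applying `Λⁿ` returns the scalar `(n!)² c`. -/
theorem toForm_smul_Om_pow_eq_zero (hB : IsHermInner (G z)) {m : ℕ} (hm : m = 2 * n) {c : ℂ} :
    toForm m (c • Om (hf G z) ^ n) = 0 ↔ c = 0 := by
  subst hm
  refine ⟨fun h => ?_, by rintro rfl; rw [zero_smul, map_zero]⟩
  have h1 := lamPow_toForm G z n (c • Om (hf G z) ^ n)
  have h2 := lamPow_toForm G z n 0
  rw [h, ← map_zero (toForm (2 * n)), h2] at h1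
  have h3 (x : Ext n) : (extLam (hInv G z))^[n] x = (extLam (hInv G z) ^ n) x := by
    rw [Module.End.pow_apply]
  rw [h3, h3, map_smul, map_zero, map_zero, ← h3, extLam_iterate_Om_pow (isInv_hf hB) n le_rfl,
    Nat.sub_self, pow_zero, smul_smul, eq_comm, toForm_zero_smul_one_eq_zero] at h1
  refine (mul_eq_zero.1 h1).resolve_right (mul_ne_zero ?_ ?_)
  · rw [Nat.descFactorial_self]; exact Nat.cast_ne_zero.2 (Nat.factorial_ne_zero _)
  · exact Nat.cast_ne_zero.2 (Nat.factorial_ne_zero _)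

/-! ### The two equivalences at a point of a chart -/

theorem IsHermOn.wedge_eq (hG : IsHermOn G s) (hz : z ∈ s) {k : ℕ} (hk : 1 ≤ k) :
    wedge (iDelDelbarOmegaPow G k z) (omegaPow G (n - k - 1) z) =
      toForm (2 * (k + 1) + 2 * (n - k - 1)) (Om (hf G z) ^ (n - k - 1) * extDdb G k z) := by
  rw [hG.iDelDelbar_eq hz hk, omegaPow_eq_toForm, wedge_toForm (extDdb_mem hk) (Om_pow_mem _ _),
    ((Om_commute (hf G z) _).pow_left (n - k - 1)).eq]

theorem IsHermOn.wedge_eq_zero_iff_lamPow (hG : IsHermOn G s) (hz : z ∈ s) {k : ℕ} (hk : 1 ≤ k)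
    (hkn : k ≤ n - 1) (hn : 3 ≤ n) :
    wedge (iDelDelbarOmegaPow G k z) (omegaPow G (n - k - 1) z) = 0 ↔
      lamPow G z (k + 1) (iDelDelbarOmegaPow G k z) = 0 := by
  have hB := hG.inner z hz
  obtain ⟨c, hc, h1⟩ := exists_Om_pow_mul_eq (isInv_hf hB) (p := k + 1) (m := n - k - 1) (by omega)
    (extDdb_mem (G := G) (z := z) hk)
  -- `Λ^{k+1}` lands in degree 0, so both conditions test the vanishing of one scalar.
  have h2 := eps_smul_one (extLam_iterate_mem (k := hInv G z) (extDdb_mem (G := G) (z := z) hk))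
  rw [hG.wedge_eq hz hk, h1, hG.iDelDelbar_eq hz hk, lamPow_toForm, h2, mul_smul_comm, mul_one,
    smul_smul, toForm_smul_Om_pow_eq_zero hB (by omega), toForm_zero_smul_one_eq_zero]
  simp [hc]

theorem IsHermOn.wedge_eq_zero_iff_scalar (hG : IsHermOn G s) (hz : z ∈ s) {k : ℕ} (hk : 1 ≤ k)
    (hkn : k ≤ n - 1) (hn : 3 ≤ n) :
    wedge (iDelDelbarOmegaPow G k z) (omegaPow G (n - k - 1) z) = 0 ↔
      chernScalar G z - chernScalarHat G z = ((k : ℂ) - 1) / ((n : ℂ) - 2) * normSqDelStarOmega G z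
        + ((n : ℂ) - 1 - (k : ℂ)) / ((n : ℂ) - 2) * normSqDelOmega G z := by
  have hB := hG.inner z hz
  have n0 : (n : ℂ) ≠ 0 := Nat.cast_ne_zero.2 (by omega)
  have n1 : (n : ℂ) - 1 ≠ 0 := sub_ne_zero.2 (by exact_mod_cast (by omega : n ≠ 1))
  have n2 : (n : ℂ) - 2 ≠ 0 := sub_ne_zero.2 (by exact_mod_cast (by omega : n ≠ 2))
  have k0 : (k : ℂ) ≠ 0 := Nat.cast_ne_zero.2 (by omega)
  have hne : (n : ℂ) * (n - 1) * (n - 2) ≠ 0 := mul_ne_zero (mul_ne_zero n0 n1) n2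
  have h1 := hG.Om_pow_mul_extDdb hz hn hk hkn
  rw [← eq_inv_smul_iff₀ hne, smul_smul] at h1
  rw [hG.wedge_eq hz hk, h1, toForm_smul_Om_pow_eq_zero hB (by omega), mul_eq_zero,
    or_iff_right (inv_ne_zero hne), mul_eq_zero, or_iff_right k0, hG.chernScalar_sub hz]
  field_simp
  constructor <;> intro h <;> linear_combination -h

/-! ### Hermitian manifolds -/

section Manifold

variable {M : Type*} [TopologicalSpace M] [ChartedSpace (Cn n) M]

/-- The differential of `φ` is a left inverse. Injectivity keeps the pulled-back metric positive
definite. -/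
theorem mfderiv_symm_injective {φ : OpenPartialHomeomorph M (Cn n)} (hφ : φ ∈ holomorphicCharts n M)
    (hz : z ∈ φ.target) :
    Function.Injective (mfderiv 𝓘(ℂ, Cn n) 𝓘(ℂ, Cn n) φ.symm z) := by
  have hd : φ.MDifferentiable 𝓘(ℂ, Cn n) 𝓘(ℂ, Cn n) :=
    ⟨(contMDiffOn_of_mem_maximalAtlas hφ).mdifferentiableOn (by simp),
      (contMDiffOn_symm_of_mem_maximalAtlas hφ).mdifferentiableOn (by simp)⟩
  have h1 := hd.comp_symm_deriv hz
  exact Function.LeftInverse.injective fun u => DFunLike.congr_fun h1 u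

/-- Complex linearity of `T` is what preserves `J`-invariance: holomorphic charts intertwine the
complex structures. -/
theorem IsHermInner.pullback (b : Cn n →ₗ[ℝ] Cn n →ₗ[ℝ] ℝ) (symm : ∀ u v, b u v = b v u)
    (pos : ∀ u, u ≠ 0 → 0 < b u u) (herm : ∀ u v, b (Complex.I • u) (Complex.I • v) = b u v)
    (T : Cn n →L[ℂ] Cn n) (hT : Function.Injective T) :
    IsHermInner fun u v => b (T u) (T v) where
  add_left u v w := by simp
  smul_left c u w := by
    have : T (c • u) = c • T u := T.map_smul_of_tower c u
    simp [this]
  symm u v := symm _ _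
  pos u hu := pos _ fun h => hu (hT (by rw [h, map_zero]))
  herm u v := by
    have h (u : Cn n) : T (J n u) = Complex.I • T u := T.map_smul Complex.I u
    rw [h, h, herm]

theorem HermitianMetric.isHermOn (g : HermitianMetric n M) {φ : OpenPartialHomeomorph M (Cn n)}
    (hφ : φ ∈ holomorphicCharts n M) : IsHermOn (g.local φ) φ.target where
  isOpen := φ.open_target
  smooth := g.smooth φ hφ
  inner z hz := IsHermInner.pullback (g.toBilin (φ.symm z)) (g.symm _) (g.pos _) (g.hermitian _)
    (mfderiv 𝓘(ℂ, Cn n) 𝓘(ℂ, Cn n) φ.symm z) (mfderiv_symm_injective hφ hz)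

end Manifold

end

end HermitianGeometry

end

theorem proposition1p6 {n : ℕ} (hn : 3 ≤ n) {M : Type*} [TopologicalSpace M]
    [ChartedSpace (HermitianGeometry.Cn n) M]
    [IsManifold 𝓘(ℂ, HermitianGeometry.Cn n) ω M]
    (g : HermitianGeometry.HermitianMetric n M) (k : ℕ) (hk : 1 ≤ k) (hkn : k ≤ n - 1) :
    List.TFAE [
      g.IsKGauduchon k,
      ∀ φ ∈ HermitianGeometry.holomorphicCharts n M, ∀ z ∈ φ.target,
        HermitianGeometry.lamPow (g.local φ) z (k + 1)
          (HermitianGeometry.iDelDelbarOmegaPow (g.local φ) k z) = 0,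
      ∀ φ ∈ HermitianGeometry.holomorphicCharts n M, ∀ z ∈ φ.target,
        HermitianGeometry.chernScalar (g.local φ) z - HermitianGeometry.chernScalarHat (g.local φ) z
          = ((k : ℂ) - 1) / ((n : ℂ) - 2) * HermitianGeometry.normSqDelStarOmega (g.local φ) z
            + ((n : ℂ) - 1 - (k : ℂ)) / ((n : ℂ) - 2)
              * HermitianGeometry.normSqDelOmega (g.local φ) z] := by
  tfae_have 1 ↔ 2 := forall₄_congr fun φ hφ z hz =>
    (g.isHermOn hφ).wedge_eq_zero_iff_lamPow hz hk hkn hn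
  tfae_have 1 ↔ 3 := forall₄_congr fun φ hφ z hz =>
    (g.isHermOn hφ).wedge_eq_zero_iff_scalar hz hk hkn hn
  tfae_finish
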